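/- Let $J=\mathrm{diag}(-1,1,1)$, $SO_0(2,1)=\{C\in GL(3,\mathbb R)\mid C^{T}JC=J,\ \det C=1,\ C_{11}>0\}$, and let $G=SO_0(2,1)\times\mathbb R$ be realized by the block-diagonal $4\times4$ matrices $(C,v)=\mathrm{diag}(C,e^{v})$. Let $e_{jk}$ denote the matrix units. The Lie algebra of $G$ has the basis $$E_1=e_{13}+e_{31},\quad E_2=e_{12}+e_{21},\quad E_3=e_{23}-e_{32},\quad E_4=e_{44}.$$ Put $(e_1,e_2,e_3,e_4)=(E_1,\,E_4-E_3,\,E_2,\,-E_3)$ for $i=1$ and $(e_1,e_2,e_3,e_4)=(E_1,\,E_4,\,E_2,\,-E_3)$ for $i=2$. Let $\rho_i$ be the left-invariant sub-Riemannian metric on $G$ defined by the left-invariant distribution spanned at $\mathrm{Id}$ by $e_1,e_2,e_3$ and the inner product for which $e_1,e_2,e_3$ are orthonormal. Its normal geodesics starting at $\mathrm{Id}$ and parametrized by arclength are $$\gamma_i(\alpha_1,\alpha_2,\alpha_3,\beta;t)=\mathrm{Exp}_i(\alpha_1,\alpha_2,\alpha_3,\beta,t)=\exp\bigl(t(\alpha_1e_1+\alpha_2e_2+\alpha_3e_3+\beta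 e_4)\bigr)\exp(-t\beta e_4),$$ where $\alpha=(\alpha_1,\alpha_2,\alpha_3)\in\mathbb S^2$ (that is, $\alpha_1^2+\alpha_2^2+\alpha_3^2=1$) and $\beta\in\mathbb R$. A number $t>0$ is a conjugate time along $\gamma_i(\alpha,\beta;\cdot)$ if the differential at $(\alpha,\beta,t)$ of $\mathrm{Exp}_i:\mathbb S^2\times\mathbb R\times\mathbb R_+\to G$ is degenerate; $t^n_{\mathrm{conj}}$ denotes the $n$-th conjugate time in ascending order. The first conjugate locus $\mathrm{Conj}^1_i$ is the set of all points $\gamma_i(\alpha,\beta;t^1)$, where $\alpha\in\mathbb S^2$, $\beta\in\mathbb R$ and $t^1$ is the infimum of the conjugate times along $\gamma_i(\alpha,\beta;\cdot)$, provided that conjugate times exist and $t^1>0$. Let $$w_1=\sqrt{(\alpha_2+\beta)^2+\alpha_2^2-1},\qquad w_2=\sqrt{\beta^2+\alpha_2^2-1}.$$ Then for $i=1,2$ the following hold. 1. If $\alpha\in\mathbb S^2$, $\alpha_2\neq\pm1$, and $w_i$ is real and positive, then the conjugate times along $\gamma_i(\alpha_1,\alpha_2,\alpha_3,\beta;t)$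 form an infinite ascending sequence $t^1_{\mathrm{conj}}<t^2_{\mathrm{conj}}<\dots$, and $$t_{\mathrm{conj}}^{2m-1}=\frac{2\pi m}{w_i},\qquad t_{\mathrm{conj}}^{2m}=\frac{2x_m}{w_i},\qquad m=1,2,\dots,$$ where $x_1<x_2<\dots$ are all the positive roots of the equation $\tan x=x$ in ascending order. 2. The first conjugate locus has the form $$\mathrm{Conj}^1_1=\mathrm{Conj}^1_2=\left\{(C,v)\in SO_0(2,1)\times\mathbb R\ \middle|\ C=\begin{pmatrix}1&0&0\\0&\cos\psi&-\sin\psi\\0&\sin\psi&\cos\psi\end{pmatrix},\ \psi,v\in\mathbb R\right\}.$$ -/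

import Mathlib

namespace SubRiem

open Matrix

/-- Labels of the two left-invariant sub-Riemannian metrics `ρ₁`, `ρ₂`. -/
inductive MetricIndex
  | one
  | two

/-- Real `4 × 4` matrices, in which the group and its Lie algebra are realized. -/
abbrev Mat4 := Matrix (Fin 4) (Fin 4) ℝ

noncomputable section

/-- `J = diag(-1, 1, 1)`. -/
def lorentzJ : Matrix (Fin 3) (Fin 3) ℝ := Matrix.diagonal ![-1, 1, 1]

/-- The restricted Lorentz group `SO₀(2,1)`. -/
def SO21 : Set (Matrix (Fin 3) (Fin 3) ℝ) :=
  {g | gᵀ * lorentzJ * g = lorentzJ ∧ g.det = 1 ∧ 0 < g 0 0}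

/-- The element `(C, v)`, i.e. the block diagonal matrix `diag(C, e^v)`. -/
def blockElt (C : Matrix (Fin 3) (Fin 3) ℝ) (v : ℝ) : Mat4 :=
  !![C 0 0, C 0 1, C 0 2, 0;
     C 1 0, C 1 1, C 1 2, 0;
     C 2 0, C 2 1, C 2 2, 0;
     0, 0, 0, Real.exp v]

/-- The matrix of `SO₀(2,1)` rotating by the angle `ψ` around the first axis. -/
def rotationFirstAxis (ψ : ℝ) : Matrix (Fin 3) (Fin 3) ℝ :=
  !![1, 0, 0;
     0, Real.cos ψ, -Real.sin ψ;
     0, Real.sin ψ, Real.cos ψ]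

/-- The vector `E₁` of the basis `E₁, E₂, E₃, E₄` of the Lie algebra `𝔰𝔬(2,1) ⊕ ℝ` (matrix units
are indexed from `0`). -/
def basisE1 : Mat4 := Matrix.single 0 2 1 + Matrix.single 2 0 1
/-- The vector `E₂`. -/
def basisE2 : Mat4 := Matrix.single 0 1 1 + Matrix.single 1 0 1
/-- The vector `E₃`. -/
def basisE3 : Mat4 := Matrix.single 1 2 1 - Matrix.single 2 1 1
/-- The vector `E₄`. -/
def basisE4 : Mat4 := Matrix.single 3 3 1

/-- The basis `e₁, e₂, e₃, e₄` of the Lie algebra adapted to the metric `ρᵢ`: the left-invariant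
distribution is spanned at the identity by `e₁, e₂, e₃`, which are orthonormal for `ρᵢ`. -/
def frame : MetricIndex → Fin 4 → Mat4
  | .one => ![basisE1, basisE4 - basisE3, basisE2, -basisE3]
  | .two => ![basisE1, basisE4, basisE2, -basisE3]

/-- The exponential map
`Expᵢ(α₁, α₂, α₃, β, t) = exp(t(α₁e₁ + α₂e₂ + α₃e₃ + βe₄)) exp(-tβe₄)`,
written on all of `ℝ³ × ℝ × ℝ`. -/
def expMap (i : MetricIndex) (p : (Fin 3 → ℝ) × ℝ × ℝ) : Mat4 :=
  NormedSpace.exp (p.2.2 • (p.1 0 • frame i 0 + p.1 1 • frame i 1 + p.1 2 • frame i 2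
    + p.2.1 • frame i 3)) * NormedSpace.exp ((-(p.2.2 * p.2.1)) • frame i 3)

/-- The geodesic `γᵢ(α₁, α₂, α₃, β; t)`. -/
def geodesic (i : MetricIndex) (α : Fin 3 → ℝ) (β t : ℝ) : Mat4 :=
  expMap i (α, β, t)

/-- The unit sphere `𝕊² ⊆ ℝ³`. -/
def unitSphere : Set (Fin 3 → ℝ) := {α | α 0 ^ 2 + α 1 ^ 2 + α 2 ^ 2 = 1}

/-- `t` is a conjugate time along `γᵢ(α, β; ·)`: `t > 0` and `(α, β, t)` is a critical point of
`Expᵢ : 𝕊² × ℝ × ℝ₊ → SO₀(2,1) × ℝ`. Source and target both have dimension `4`, so the differential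
is degenerate iff it kills a nonzero vector tangent to `𝕊² × ℝ × ℝ₊`. -/
def IsConjugateTime (i : MetricIndex) (α : Fin 3 → ℝ) (β t : ℝ) : Prop :=
  0 < t ∧ ∃ ξ : (Fin 3 → ℝ) × ℝ × ℝ, ξ ≠ 0 ∧
    α 0 * ξ.1 0 + α 1 * ξ.1 1 + α 2 * ξ.1 2 = 0 ∧
    fderiv ℝ (expMap i) (α, β, t) ξ = 0

/-- The set of conjugate times along `γᵢ(α, β; ·)`. -/
def conjugateTimes (i : MetricIndex) (α : Fin 3 → ℝ) (β : ℝ) : Set ℝ :=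
  {t | IsConjugateTime i α β t}

/-- The first conjugate locus: all points `γᵢ(t¹)`, where `γᵢ` is a normal geodesic starting at the
identity whose first conjugate time `t¹ = inf {conjugate times}` exists and is positive. -/
def firstConjugateLocus (i : MetricIndex) : Set Mat4 :=
  {g | ∃ α ∈ unitSphere, ∃ β t₁ : ℝ,
    IsGLB (conjugateTimes i α β) t₁ ∧ 0 < t₁ ∧ g = geodesic i α β t₁}

/-- `a 1 < a 2 < ...` lists exactly the elements of `S` in ascending order. -/
def IsAscendingList (a : ℕ → ℝ) (S : Set ℝ) : Prop :=
  StrictMonoOn a (Set.Ici 1) ∧ a '' Set.Ici 1 = S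

/-- The number `wᵢ`, where `w₁² = (α₂ + β)² + α₂² - 1` and `w₂² = β² + α₂² - 1`. Only the condition
`wᵢ > 0` (real and positive) matters, and `Real.sqrt` is positive exactly when `wᵢ` is. -/
def w : MetricIndex → ℝ → ℝ → ℝ
  | .one, α₂, β => Real.sqrt ((α₂ + β) ^ 2 + α₂ ^ 2 - 1)
  | .two, α₂, β => Real.sqrt (β ^ 2 + α₂ ^ 2 - 1)

/-! The curves `geodesic` are the normal geodesics of `ρᵢ`; this is proved below and justifies
`expMap`. -/

/-- `γ` is a normal geodesic of `ρᵢ`, parametrized by arclength, with `γ 0 = Id`: it solves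
`γ' = γ u`, `u = ψ₁e₁ + ψ₂e₂ + ψ₃e₃`, `|u(0)| = 1`, where `ψ` solves the vertical part
`ψⱼ' = ∑ₖ ∑_{l ≤ 3} C_{lj}^k ψₗ ψₖ` of the Hamiltonian system; `C` are the structure constants. -/
def IsNormalGeodesic (i : MetricIndex) (γ : ℝ → Mat4) : Prop :=
  ∃ (c : Fin 4 → Fin 4 → Fin 4 → ℝ) (ψ : ℝ → Fin 4 → ℝ),
    (∀ l j, frame i l * frame i j - frame i j * frame i l = ∑ k, c l j k • frame i k) ∧
    γ 0 = 1 ∧ ψ 0 0 ^ 2 + ψ 0 1 ^ 2 + ψ 0 2 ^ 2 = 1 ∧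
    (∀ t, HasDerivAt γ (γ t * ∑ l : Fin 3, ψ t l.castSucc • frame i l.castSucc) t) ∧
    ∀ t j, HasDerivAt (fun s => ψ s j)
      (∑ k, ∑ l : Fin 3, c l.castSucc j k * ψ t l.castSucc * ψ t k) t

end

section

theorem basis_eq : basisE1 = !![0, 0, 1, 0; 0, 0, 0, 0; 1, 0, 0, 0; 0, 0, 0, 0] ∧
    basisE2 = !![0, 1, 0, 0; 1, 0, 0, 0; 0, 0, 0, 0; 0, 0, 0, 0] ∧
    basisE3 = !![0, 0, 0, 0; 0, 0, 1, 0; 0, -1, 0, 0; 0, 0, 0, 0] ∧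
    basisE4 = !![0, 0, 0, 0; 0, 0, 0, 0; 0, 0, 0, 0; 0, 0, 0, 1] := by
  refine ⟨?_, ?_, ?_, ?_⟩ <;> ext a b <;> fin_cases a <;> fin_cases b <;>
    simp [basisE1, basisE2, basisE3, basisE4]

/-- A combination of the frame, as an explicit matrix. -/
def comb (d : ℝ) (v : Fin 4 → ℝ) : Mat4 :=
  !![0, v 2, v 0, 0; v 2, 0, -(d * v 1 + v 3), 0; v 0, d * v 1 + v 3, 0, 0; 0, 0, 0, v 1]

theorem frame_comb (i : MetricIndex) : ∃ d : ℝ, ∀ v : Fin 4 → ℝ,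
    ∑ k, v k • frame i k = comb d v := by
  obtain ⟨h1, h2, h3, h4⟩ := basis_eq
  cases i
  · refine ⟨1, fun v => ?_⟩
    simp [Fin.sum_univ_four, frame, h1, h2, h3, h4, comb, Matrix.smul_of, add_comm]
  · refine ⟨0, fun v => ?_⟩
    simp [Fin.sum_univ_four, frame, h1, h2, h3, h4, comb, Matrix.smul_of]

theorem comb_inj {d : ℝ} {v v' : Fin 4 → ℝ} (h : comb d v = comb d v') : v = v' := by
  have h02 := congrFun (congrFun h 0) 2
  have h01 := congrFun (congrFun h 0) 1
  have h12 := congrFun (congrFun h 2) 1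
  have h33 := congrFun (congrFun h 3) 3
  simp [comb] at h02 h01 h12 h33
  rw [h33] at h12
  ext k; fin_cases k <;> simp_all

/-- The bracket in coordinates. -/
def brk (d : ℝ) (v v' : Fin 4 → ℝ) : Fin 4 → ℝ :=
  ![(d * v 1 + v 3) * v' 2 - (d * v' 1 + v' 3) * v 2, 0,
    v 0 * (d * v' 1 + v' 3) - v' 0 * (d * v 1 + v 3), v 0 * v' 2 - v' 0 * v 2]

theorem comb_bracket (d : ℝ) (v v' : Fin 4 → ℝ) :
    comb d v * comb d v' - comb d v' * comb d v = comb d (brk d v v') := by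
  simp only [comb, brk]
  ext a b; fin_cases a <;> fin_cases b <;> simp <;> ring

theorem comb_add (d : ℝ) (v v' : Fin 4 → ℝ) : comb d (v + v') = comb d v + comb d v' := by
  simp only [comb]
  ext a b; fin_cases a <;> fin_cases b <;> simp <;> ring

theorem comb_smul (d r : ℝ) (v : Fin 4 → ℝ) : comb d (r • v) = r • comb d v := by
  simp only [comb]
  ext a b; fin_cases a <;> fin_cases b <;> simp <;> ring

theorem frame_eq {i : MetricIndex} {d : ℝ} (hd : ∀ v : Fin 4 → ℝ,
    ∑ k, v k • frame i k = comb d v) (l : Fin 4) : frame i l = comb d (Pi.single l 1) := by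
  rw [← hd]; simp [Pi.single_apply]

theorem quad_eq {i : MetricIndex} {d : ℝ} (hd : ∀ v : Fin 4 → ℝ,
    ∑ k, v k • frame i k = comb d v) {c : Fin 4 → Fin 4 → Fin 4 → ℝ}
    (hc : ∀ l j, frame i l * frame i j - frame i j * frame i l = ∑ k, c l j k • frame i k)
    (x : Fin 4 → ℝ) (j : Fin 4) :
    ∑ k, ∑ l : Fin 3, c l.castSucc j k * x l.castSucc * x k =
      ![-x 2 * (d * x 1 + x 3), 0, x 0 * (d * x 1 + x 3), 0] j := by
  have hc' : ∀ l j, c l j = brk d (Pi.single l 1) (Pi.single j 1) := fun l j => by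
    apply comb_inj (d := d)
    rw [← comb_bracket, ← frame_eq hd, ← frame_eq hd, hc, hd]
  simp only [hc', brk]
  fin_cases j <;> simp [Fin.sum_univ_four, Fin.sum_univ_three, Pi.single_apply] <;> ring

theorem exists_c {i : MetricIndex} {d : ℝ} (hd : ∀ v : Fin 4 → ℝ,
    ∑ k, v k • frame i k = comb d v) : ∃ c : Fin 4 → Fin 4 → Fin 4 → ℝ,
    ∀ l j, frame i l * frame i j - frame i j * frame i l = ∑ k, c l j k • frame i k :=
  ⟨fun l j => brk d (Pi.single l 1) (Pi.single j 1), fun l j => by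
    rw [hd, frame_eq hd, frame_eq hd, comb_bracket]⟩

attribute [local instance] Matrix.linftyOpNormedRing Matrix.linftyOpNormedAlgebra

theorem hasDerivAt_exp' (A : Mat4) (t : ℝ) :
    HasDerivAt (fun u : ℝ => NormedSpace.exp (u • A)) (NormedSpace.exp (t • A) * A) t :=
  hasDerivAt_exp_smul_const A t

theorem exp_mul_neg (A : Mat4) (t : ℝ) :
    NormedSpace.exp (t • A) * NormedSpace.exp ((-t) • A) = 1 := by
  rw [← Matrix.exp_add_of_commute]
  · simp
  · exact ((Commute.refl A).smul_left _).smul_right _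

theorem const_of_deriv {f : ℝ → Mat4} (h : ∀ t, HasDerivAt f 0 t) (t : ℝ) : f t = f 0 :=
  is_const_of_deriv_eq_zero (fun s => (h s).differentiableAt) (fun s => (h s).deriv) t 0

theorem const_of_deriv' {f : ℝ → ℝ} (h : ∀ t, HasDerivAt f 0 t) (t : ℝ) : f t = f 0 :=
  is_const_of_deriv_eq_zero (fun s => (h s).differentiableAt) (fun s => (h s).deriv) t 0

/-- The velocity `u(t) + βe₄` in coordinates. -/
noncomputable def vel (α : Fin 3 → ℝ) (β t : ℝ) : Fin 4 → ℝ :=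
  ![α 0 * Real.cos (β * t) + α 2 * Real.sin (β * t), α 1,
    -α 0 * Real.sin (β * t) + α 2 * Real.cos (β * t), 0]

theorem hasDerivAt_comb_vel (d : ℝ) (α : Fin 3 → ℝ) (β t : ℝ) :
    HasDerivAt (fun s => comb d (vel α β s)) (β • (comb d (Pi.single 3 1) * comb d (vel α β t) -
      comb d (vel α β t) * comb d (Pi.single 3 1))) t := by
  have hs : HasDerivAt (fun s => Real.sin (β * s)) (Real.cos (β * t) * β) t := by
    simpa using ((hasDerivAt_id t).const_mul β).sin
  have hc : HasDerivAt (fun s => Real.cos (β * s)) (-Real.sin (β * t) * β) t := by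
    simpa using ((hasDerivAt_id t).const_mul β).cos
  have e : (fun s => comb d (vel α β s)) = fun s =>
      (Real.cos (β * s)) • comb d ![α 0, 0, α 2, 0] +
      (Real.sin (β * s)) • comb d ![α 2, 0, -α 0, 0] + comb d ![0, α 1, 0, 0] := by
    funext s
    rw [← comb_smul, ← comb_smul, ← comb_add, ← comb_add]
    congr 1; ext k; fin_cases k <;> simp [vel] <;> ring
  rw [e]
  have := ((hc.smul_const (comb d ![α 0, 0, α 2, 0])).add
    (hs.smul_const (comb d ![α 2, 0, -α 0, 0]))).add_const (comb d ![0, α 1, 0, 0])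
  refine this.congr_deriv ?_
  rw [comb_bracket, ← comb_smul, ← comb_smul, ← comb_smul, ← comb_add]
  congr 1; ext k; fin_cases k <;> simp [vel, brk] <;> ring

theorem conj_vel (d : ℝ) (α : Fin 3 → ℝ) (β t : ℝ) :
    NormedSpace.exp (t • (-(β • comb d (Pi.single 3 1)))) *
      (comb d (vel α β t) + β • comb d (Pi.single 3 1)) =
    (comb d (vel α β 0) + β • comb d (Pi.single 3 1)) *
      NormedSpace.exp (t • (-(β • comb d (Pi.single 3 1)))) := by
  set B := comb d (Pi.single 3 1) with hB
  have h1 := fun t => hasDerivAt_exp' (-(β • B)) t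
  have h2 := fun t => hasDerivAt_exp' (β • B) t
  have hcomm : ∀ t : ℝ, NormedSpace.exp (t • (β • B)) * B = B * NormedSpace.exp (t • (β • B)) :=
    fun t => ((((Commute.refl B).smul_left β).smul_left t).exp_left).eq
  have key := const_of_deriv (f := fun t => NormedSpace.exp (t • (-(β • B))) *
    (comb d (vel α β t) + β • B) * NormedSpace.exp (t • (β • B))) (fun t => by
      refine (((h1 t).mul ((hasDerivAt_comb_vel d α β t).add_const (β • B))).mul (h2 t)).congr_deriv ?_
      have : NormedSpace.exp (t • (β • B)) * (β • B) = (β • B) * NormedSpace.exp (t • (β • B)) := by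
        rw [mul_smul_comm, hcomm, smul_mul_assoc]
      simp only [Pi.mul_apply]
      rw [this, ← hB]
      simp only [smul_sub, mul_add, add_mul, mul_sub, sub_mul, smul_mul_assoc, mul_smul_comm, mul_assoc,
        mul_neg, neg_mul, smul_add]
      generalize NormedSpace.exp (t • -(β • B)) = P
      module) t
  simp only [zero_smul, NormedSpace.exp_zero, one_mul, mul_one] at key
  have hinv := exp_mul_neg (β • B) t
  rw [neg_smul, ← smul_neg] at hinv
  rw [← key, mul_assoc _ _ (NormedSpace.exp (t • (-(β • B)))), hinv, mul_one]


theorem expMap_eq {i : MetricIndex} {d : ℝ} (hd : ∀ v : Fin 4 → ℝ,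
    ∑ k, v k • frame i k = comb d v) (α : Fin 3 → ℝ) (β t : ℝ) :
    geodesic i α β t =
      NormedSpace.exp (t • (comb d (vel α β 0) + β • comb d (Pi.single 3 1))) *
        NormedSpace.exp (t • (-(β • comb d (Pi.single 3 1)))) := by
  have h : α 0 • frame i 0 + α 1 • frame i 1 + α 2 • frame i 2 + β • frame i 3 =
      comb d (vel α β 0) + β • comb d (Pi.single 3 1) := by
    rw [← comb_smul, ← comb_add, ← hd]
    simp [Fin.sum_univ_four, vel]
  simp only [geodesic, expMap]
  rw [h, frame_eq hd]
  congr 2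
  module

theorem geodesic_deriv {i : MetricIndex} {d : ℝ} (hd : ∀ v : Fin 4 → ℝ,
    ∑ k, v k • frame i k = comb d v) (α : Fin 3 → ℝ) (β t : ℝ) :
    HasDerivAt (geodesic i α β) (geodesic i α β t * comb d (vel α β t)) t := by
  have h0 : geodesic i α β = _ := funext (expMap_eq hd α β)
  rw [h0]
  refine ((hasDerivAt_exp' _ t).mul (hasDerivAt_exp' _ t)).congr_deriv ?_
  rw [mul_assoc (NormedSpace.exp _) (comb d (vel α β 0) + β • comb d (Pi.single 3 1)),
    ← conj_vel]
  simp only [mul_add, mul_assoc, mul_neg]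
  abel

theorem geodesic_unique {i : MetricIndex} {d : ℝ} (hd : ∀ v : Fin 4 → ℝ,
    ∑ k, v k • frame i k = comb d v) (α : Fin 3 → ℝ) (β : ℝ) {γ : ℝ → Mat4} (h0 : γ 0 = 1)
    (hγ : ∀ t, HasDerivAt γ (γ t * comb d (vel α β t)) t) : γ = geodesic i α β := by
  set B := comb d (Pi.single 3 1) with hB
  set X := comb d (vel α β 0) + β • B with hX
  have hKK : ∀ t : ℝ, NormedSpace.exp (t • (β • B)) * NormedSpace.exp (t • (-(β • B))) = 1 :=
    fun t => by simpa using exp_mul_neg (β • B) t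
  have hKK' : ∀ t : ℝ, NormedSpace.exp (t • (-(β • B))) * NormedSpace.exp (t • (β • B)) = 1 :=
    fun t => by simpa using exp_mul_neg (-(β • B)) t
  have hEE : ∀ t : ℝ, NormedSpace.exp (t • (-X)) * NormedSpace.exp (t • X) = 1 :=
    fun t => by simpa using exp_mul_neg (-X) t
  have hconj : ∀ t, (comb d (vel α β t) + β • B) * NormedSpace.exp (t • (β • B)) =
      NormedSpace.exp (t • (β • B)) * X := fun t => by
    have := conj_vel d α β t
    rw [← hB, ← hX] at this
    calc _ = NormedSpace.exp (t • (β • B)) * (NormedSpace.exp (t • (-(β • B))) *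
          (comb d (vel α β t) + β • B)) * NormedSpace.exp (t • (β • B)) := by
            rw [← mul_assoc, hKK, one_mul]
      _ = _ := by rw [this, mul_assoc, mul_assoc, hKK', mul_one]
  have hcomm : ∀ t : ℝ, NormedSpace.exp (t • (β • B)) * (β • B) =
      (β • B) * NormedSpace.exp (t • (β • B)) :=
    fun t => (((Commute.refl (β • B)).smul_left t).exp_left).eq
  have hcommX : ∀ t : ℝ, NormedSpace.exp (t • (-X)) * X = X * NormedSpace.exp (t • (-X)) :=
    fun t => (((Commute.refl X).neg_left.smul_left t).exp_left).eq
  have key := const_of_deriv (f := fun t => γ t * NormedSpace.exp (t • (β • B)) *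
    NormedSpace.exp (t • (-X))) (fun t => by
      refine (((hγ t).mul (hasDerivAt_exp' (β • B) t)).mul
        (hasDerivAt_exp' (-X) t)).congr_deriv ?_
      simp only [Pi.mul_apply]
      have e1 : γ t * comb d (vel α β t) * NormedSpace.exp (t • (β • B)) +
          γ t * (NormedSpace.exp (t • (β • B)) * (β • B)) =
          γ t * NormedSpace.exp (t • (β • B)) * X := by
        rw [hcomm, mul_assoc, ← mul_add, ← add_mul, hconj, mul_assoc]
      rw [e1, mul_neg, hcommX]
      simp only [mul_assoc, mul_neg]
      abel)
  funext t
  have k := key t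
  simp only [zero_smul, NormedSpace.exp_zero, mul_one, h0] at k
  rw [expMap_eq hd, ← hB, ← hX]
  calc γ t = γ t * NormedSpace.exp (t • (β • B)) * (NormedSpace.exp (t • (-X)) *
        NormedSpace.exp (t • X)) * NormedSpace.exp (t • (-(β • B))) := by
          rw [hEE, mul_one, mul_assoc, hKK, mul_one]
    _ = _ := by rw [← mul_assoc, k, one_mul]

/-- The normal geodesics of `ρᵢ` that start at the identity and are parametrized by arclength are
exactly the curves `γᵢ(α, β; ·)` with `α ∈ 𝕊²` and `β ∈ ℝ`. -/
theorem isNormalGeodesic_iff (i : MetricIndex) (γ : ℝ → Mat4) :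
    IsNormalGeodesic i γ ↔ ∃ α ∈ unitSphere, ∃ β : ℝ, γ = geodesic i α β := by
  obtain ⟨d, hd⟩ := frame_comb i
  have hu : ∀ x : Fin 4 → ℝ, ∑ l : Fin 3, x l.castSucc • frame i l.castSucc =
      comb d ![x 0, x 1, x 2, 0] := fun x => by
    rw [← hd]; simp [Fin.sum_univ_four, Fin.sum_univ_three]
  have hsin : ∀ β t, HasDerivAt (fun s => Real.sin (β * s)) (Real.cos (β * t) * β) t :=
    fun β t => by simpa using ((hasDerivAt_id t).const_mul β).sin
  have hcos : ∀ β t, HasDerivAt (fun s => Real.cos (β * s)) (-Real.sin (β * t) * β) t :=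
    fun β t => by simpa using ((hasDerivAt_id t).const_mul β).cos
  constructor
  · rintro ⟨c, ψ, hc, h0, hn, hγ, hψ⟩
    simp only [quad_eq hd hc] at hψ
    have h1 : ∀ t, ψ t 1 = ψ 0 1 := const_of_deriv' fun t => by simpa using hψ t 1
    have h3 : ∀ t, ψ t 3 = ψ 0 3 := const_of_deriv' fun t => by simpa using hψ t 3
    obtain ⟨β, hβ⟩ : ∃ β, β = -(d * ψ 0 1 + ψ 0 3) := ⟨_, rfl⟩
    have g0 : ∀ t, HasDerivAt (fun s => ψ s 0) (β * ψ t 2) t := fun t => by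
      refine (hψ t 0).congr_deriv ?_
      simp [h1 t, h3 t, hβ]; ring
    have g2 : ∀ t, HasDerivAt (fun s => ψ s 2) (-(β * ψ t 0)) t := fun t => by
      refine (hψ t 2).congr_deriv ?_
      simp [h1 t, h3 t, hβ]; ring
    have hP : ∀ t, ψ t 0 * Real.cos (β * t) - ψ t 2 * Real.sin (β * t) = ψ 0 0 := fun t => by
      simpa using const_of_deriv'
        (f := fun t => ψ t 0 * Real.cos (β * t) - ψ t 2 * Real.sin (β * t)) (fun t =>
        (((g0 t).mul (hcos β t)).sub ((g2 t).mul (hsin β t))).congr_deriv (by ring)) t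
    have hQ : ∀ t, ψ t 0 * Real.sin (β * t) + ψ t 2 * Real.cos (β * t) = ψ 0 2 := fun t => by
      simpa using const_of_deriv'
        (f := fun t => ψ t 0 * Real.sin (β * t) + ψ t 2 * Real.cos (β * t)) (fun t =>
        (((g0 t).mul (hsin β t)).add ((g2 t).mul (hcos β t))).congr_deriv (by ring)) t
    refine ⟨![ψ 0 0, ψ 0 1, ψ 0 2], by simpa [unitSphere] using hn, β, ?_⟩
    refine geodesic_unique hd _ _ h0 fun t => (hγ t).congr_deriv ?_
    rw [hu]
    congr 2
    have hsc := Real.sin_sq_add_cos_sq (β * t)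
    ext k; fin_cases k <;> simp [vel, h1 t]
    · rw [← hP t, ← hQ t]; linear_combination (-ψ t 0) * hsc
    · rw [← hP t, ← hQ t]; linear_combination (-ψ t 2) * hsc
  · rintro ⟨α, hα, β, rfl⟩
    obtain ⟨c, hc⟩ := exists_c hd
    refine ⟨c, fun t => ![vel α β t 0, α 1, vel α β t 2, -β - d * α 1], hc, ?_, ?_, ?_, ?_⟩
    · simp [expMap_eq hd]
    · simpa [vel, unitSphere] using hα
    · intro t
      refine (geodesic_deriv hd α β t).congr_deriv ?_
      rw [hu]
      congr 2
    · intro t j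
      rw [quad_eq hd hc (![vel α β t 0, α 1, vel α β t 2, -β - d * α 1])]
      fin_cases j
      · refine (((hcos β t).const_mul (α 0)).add ((hsin β t).const_mul (α 2))).congr_deriv ?_
        simp [vel]; ring
      · simpa using hasDerivAt_const t (α 1)
      · refine (((hsin β t).const_mul (-α 0)).add ((hcos β t).const_mul (α 2))).congr_deriv ?_
        simp [vel]; ring
      · simpa using hasDerivAt_const t (-β - d * α 1)

end
end SubRiem

/-! ### The differential of the matrix exponential. -/

namespace SubRiem
open Matrix Topology
section
attribute [local instance] Matrix.linftyOpNormedRing Matrix.linftyOpNormedAlgebra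

/-! Both metrics are treated at once through the parameter `d` of `comb d` (`d = 1` for the first,
`d = 0` for the second). Write `x = (α, β)` and let `κ = (dα₂ + β)² - α₁² - α₃²`, the radicand of
`wᵢ²` on the sphere. Translating the differential of `Expᵢ` back to the identity by Duhamel's
formula turns degeneracy at time `t` into a linear equation in the Lie algebra: some `h ≠ 0`
satisfies `∫₀ᵗ exp(-s ad x) h ds = t h₄ e₄` (`isConjugateTime_iff_exists`). Since `(ad x)³ = -κ ad
x`, the integral is `t - b(t) ad x + B(t) (ad x)²`, where `a`, `b`, `B` are successive primitives of
`cos(√κ s)` (of `1` or a hyperbolic cosine when `κ ≤ 0`). A `3 × 3` determinant then yields the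
criterion `(α₁² + α₃²)(aB - b²) = 0` (`isConjugateTime_iff`).

If `α₂ = ±1`, every positive time is conjugate, so the infimum is `0` and the geodesic is excluded
from the locus. Otherwise, for `κ ≤ 0` one has `aB < b²` and there are no conjugate times. For `κ =
ω² > 0`, with `y = ωt/2`, the quantity `aB - b²` is a nonzero multiple of `sin y (sin y - y cos y)`.
Its positive zeros are `mπ` and the roots `x_m` of `tan y = y`, which interlace because `mπ < x_m <
(m + 1)π`.

The first conjugate time is therefore `2π/ω`, a period of the `SO₀(2,1)` factor of `exp(tX)`. Only
the factor `exp(-tβe₄)`, a rotation, and the coordinate `v = tα₂` remain. Conversely, every pair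
`(ψ, v)` occurs after `ψ` is shifted by a large multiple of `2π` (`firstConjugateLocus_eq`). -/

theorem differentiable_matrix_exp : Differentiable ℝ (NormedSpace.exp : Mat4 → Mat4) :=
  fun x => (NormedSpace.exp_analytic (𝕂 := ℝ) x).differentiableAt

theorem continuous_matrix_exp : Continuous (NormedSpace.exp : Mat4 → Mat4) :=
  differentiable_matrix_exp.continuous

/-- Duhamel's formula, with the integral replaced by a primitive `U` of the integrand. -/
theorem hasDerivAt_exp_line (X H : Mat4) {U : ℝ → Mat4} (hU0 : U 0 = 0)
    (hU : ∀ s : ℝ, HasDerivAt U (NormedSpace.exp (s • (-X)) * H * NormedSpace.exp (s • X)) s)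
    (t : ℝ) :
    HasDerivAt (fun ε : ℝ => NormedSpace.exp (t • (X + ε • H))) (NormedSpace.exp (t • X) * U t)
      0 := by
  set g : ℝ → ℝ → Mat4 := fun ε s =>
    NormedSpace.exp (s • (-X)) * H * NormedSpace.exp (s • (X + ε • H)) with hg
  have hgc : Continuous (Function.uncurry g) := by
    refine Continuous.mul (Continuous.mul (continuous_matrix_exp.comp ?_) continuous_const)
      (continuous_matrix_exp.comp ?_) <;> fun_prop
  -- The `s`-derivative of `exp(-sX) exp(s(X + εH))` is exactly `ε g(ε, s)`: the terms in `X`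
  -- cancel. This makes the difference quotient in `ε` an integral depending continuously on `ε`.
  have hint : ∀ ε, ∫ s in (0 : ℝ)..t, ε • g ε s =
      NormedSpace.exp (t • (-X)) * NormedSpace.exp (t • (X + ε • H)) - 1 := by
    intro ε
    rw [intervalIntegral.integral_eq_sub_of_hasDerivAt (f := fun s : ℝ =>
      NormedSpace.exp (s • (-X)) * NormedSpace.exp (s • (X + ε • H)))]
    · simp
    · intro s _
      refine ((hasDerivAt_exp' (-X) s).mul (hasDerivAt_exp' (X + ε • H) s)).congr_deriv ?_
      have h1 : NormedSpace.exp (s • (X + ε • H)) * (X + ε • H) =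
          (X + ε • H) * NormedSpace.exp (s • (X + ε • H)) :=
        (((Commute.refl (X + ε • H)).smul_left s).exp_left).eq
      rw [h1, hg]
      simp only [mul_neg, neg_mul, mul_add, add_mul, mul_assoc, smul_mul_assoc, mul_smul_comm]
      abel
    · refine Continuous.intervalIntegrable ?_ _ _
      exact (hgc.comp (by fun_prop : Continuous fun s : ℝ => (ε, s))).const_smul ε
  have hI : Continuous fun ε => ∫ s in (0 : ℝ)..t, g ε s :=
    intervalIntegral.continuous_parametric_intervalIntegral_of_continuous' hgc 0 t
  have hI0 : ∫ s in (0 : ℝ)..t, g 0 s = U t := by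
    rw [intervalIntegral.integral_eq_sub_of_hasDerivAt (f := U), hU0, sub_zero]
    · intro s _
      refine HasDerivAt.congr_deriv (hU s) ?_
      simp [hg]
    · exact (hgc.comp (by fun_prop : Continuous fun s : ℝ => ((0 : ℝ), s))).intervalIntegrable _ _
  have hinv : NormedSpace.exp (t • X) * NormedSpace.exp (t • (-X)) = 1 := by
    simpa using exp_mul_neg X t
  have hfun : ∀ ε : ℝ, NormedSpace.exp (t • (X + ε • H)) =
      NormedSpace.exp (t • X) + ε • (NormedSpace.exp (t • X) * ∫ s in (0 : ℝ)..t, g ε s) := by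
    intro ε
    have h := hint ε
    rw [intervalIntegral.integral_smul] at h
    rw [← mul_smul_comm, h, mul_sub, ← mul_assoc, hinv]
    simp
  refine hasDerivAt_iff_tendsto_slope_zero.2 ?_
  have hlim : Filter.Tendsto (fun ε => NormedSpace.exp (t • X) * ∫ s in (0 : ℝ)..t, g ε s)
      (𝓝[≠] 0) (𝓝 (NormedSpace.exp (t • X) * U t)) := by
    rw [← hI0]
    exact ((continuous_const.mul hI).tendsto 0).mono_left nhdsWithin_le_nhds
  refine hlim.congr' ?_
  filter_upwards [self_mem_nhdsWithin] with ε hε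
  rw [zero_add, hfun ε, zero_smul, add_zero]
  simp only [add_sub_cancel_left]
  rw [smul_smul, inv_mul_cancel₀ hε, one_smul]

theorem fderiv_exp_apply (X H : Mat4) {U : ℝ → Mat4} (hU0 : U 0 = 0)
    (hU : ∀ s : ℝ, HasDerivAt U (NormedSpace.exp (s • (-X)) * H * NormedSpace.exp (s • X)) s)
    (t : ℝ) :
    fderiv ℝ (NormedSpace.exp : Mat4 → Mat4) (t • X) (t • H) = NormedSpace.exp (t • X) * U t := by
  have h1 := hasDerivAt_exp_line X H hU0 hU t
  have hline : HasDerivAt (fun ε : ℝ => t • (X + ε • H)) (t • H) 0 := by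
    refine ((((hasDerivAt_id (0 : ℝ)).smul_const H).const_add X).const_smul t).congr_deriv ?_
    rw [one_smul]
  have h2 := HasFDerivAt.comp_hasDerivAt_of_eq (0 : ℝ)
    (differentiable_matrix_exp (t • X)).hasFDerivAt hline (by simp)
  exact h2.unique h1

end

/-! ### Generalized trigonometric functions and the sign of `aB - b²`. -/

/-- `a, b, B` are the successive primitives, vanishing at `0`, of the solution `y` of
`y'' = -κ y`, `y 0 = 1`, `y' 0 = 0`. -/
structure IsTrigTriple (κ : ℝ) (a b B : ℝ → ℝ) : Prop where
  a_zero : a 0 = 0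
  b_zero : b 0 = 0
  B_zero : B 0 = 0
  deriv_a : ∀ s, HasDerivAt a (1 - κ * b s) s
  deriv_b : ∀ s, HasDerivAt b (a s) s
  deriv_B : ∀ s, HasDerivAt B (b s) s

namespace IsTrigTriple

variable {κ : ℝ} {a b B : ℝ → ℝ}

theorem a_eq (h : IsTrigTriple κ a b B) (t : ℝ) : a t = t - κ * B t := by
  have := const_of_deriv' (f := fun t => a t - t + κ * B t) (fun s =>
    (((h.deriv_a s).sub (hasDerivAt_id s)).add ((h.deriv_B s).const_mul κ)).congr_deriv (by ring)) t
  simp only [h.a_zero, h.B_zero] at this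
  linarith

/-- Two monotonicity steps: by `a_eq`, the derivative of `aB - b²` is `B - s b`, whose own
derivative is `-s a < 0`; both functions vanish at `0`. -/
theorem lt_sq_of_pos (h : IsTrigTriple κ a b B) (ha : ∀ s, 0 < s → 0 < a s) {t : ℝ} (ht : 0 < t) :
    a t * B t < b t ^ 2 := by
  have key : ∀ (f f' : ℝ → ℝ), (∀ s, HasDerivAt f (f' s) s) → f 0 = 0 → (∀ s, 0 < s → f' s < 0) →
      ∀ s, 0 < s → f s < 0 := by
    intro f f' hf h0 hneg s hs
    have hanti : StrictAntiOn f (Set.Ici 0) := by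
      refine strictAntiOn_of_deriv_neg (convex_Ici 0)
        (fun s _ => (hf s).continuousAt.continuousWithinAt) fun s hs => ?_
      rw [interior_Ici] at hs
      rw [(hf s).deriv]
      exact hneg s hs
    have := hanti (Set.mem_Ici.2 le_rfl) (Set.mem_Ici.2 hs.le) hs
    rwa [h0] at this
  have h1 := key (fun s => B s - s * b s) (fun s => -(s * a s))
    (fun s => ((h.deriv_B s).sub ((hasDerivAt_id s).mul (h.deriv_b s))).congr_deriv
      (by simp))
    (by simp [h.B_zero]) (fun s hs => neg_neg_of_pos (mul_pos hs (ha s hs)))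
  have h2 := key (fun s => a s * B s - b s * b s) (fun s => B s - s * b s)
    (fun s => (((h.deriv_a s).mul (h.deriv_B s)).sub
      ((h.deriv_b s).mul (h.deriv_b s))).congr_deriv (by rw [h.a_eq s]; ring))
    (by simp [h.B_zero, h.b_zero]) h1 t ht
  rw [pow_two]
  exact sub_neg.1 h2

theorem of_pos {ω : ℝ} (hω : 0 < ω) : IsTrigTriple (ω ^ 2) (fun s => Real.sin (ω * s) / ω)
    (fun s => (1 - Real.cos (ω * s)) / ω ^ 2)
    (fun s => (ω * s - Real.sin (ω * s)) / ω ^ 3) where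
  a_zero := by simp
  b_zero := by simp
  B_zero := by simp
  deriv_a s := by
    refine ((((hasDerivAt_id s).const_mul ω).sin).div_const ω).congr_deriv ?_
    simp only [id]; field_simp; ring
  deriv_b s := by
    refine (((((hasDerivAt_id s).const_mul ω).cos).const_sub 1).div_const (ω ^ 2)).congr_deriv ?_
    simp only [id]; field_simp
  deriv_B s := by
    refine (((((hasDerivAt_id s).const_mul ω)).sub
      (((hasDerivAt_id s).const_mul ω).sin)).div_const (ω ^ 3)).congr_deriv ?_
    simp only [id]; field_simp

theorem of_zero : IsTrigTriple 0 (fun s => s) (fun s => s ^ 2 / 2) (fun s => s ^ 3 / 6) where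
  a_zero := by simp
  b_zero := by simp
  B_zero := by simp
  deriv_a s := (hasDerivAt_id s).congr_deriv (by simp)
  deriv_b s := ((hasDerivAt_pow 2 s).div_const 2).congr_deriv (by simp)
  deriv_B s := ((hasDerivAt_pow 3 s).div_const 6).congr_deriv (by norm_num; ring)

theorem of_neg {ω : ℝ} (hω : 0 < ω) : IsTrigTriple (-ω ^ 2) (fun s => Real.sinh (ω * s) / ω)
    (fun s => (Real.cosh (ω * s) - 1) / ω ^ 2)
    (fun s => (Real.sinh (ω * s) - ω * s) / ω ^ 3) where
  a_zero := by simp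
  b_zero := by simp
  B_zero := by simp
  deriv_a s := by
    refine ((((hasDerivAt_id s).const_mul ω).sinh).div_const ω).congr_deriv ?_
    simp only [id]; field_simp; ring
  deriv_b s := by
    refine (((((hasDerivAt_id s).const_mul ω).cosh).sub_const 1).div_const (ω ^ 2)).congr_deriv ?_
    simp only [id]; field_simp
  deriv_B s := by
    refine (((((hasDerivAt_id s).const_mul ω).sinh).sub
      ((hasDerivAt_id s).const_mul ω)).div_const (ω ^ 3)).congr_deriv ?_
    simp only [id]; field_simp

/-- Here `a` is `s` or `sinh(ωs)/ω`, positive for `s > 0`, so `lt_sq_of_pos` applies. This is what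
rules out conjugate times when `wᵢ` is not positive. -/
theorem exists_of_nonpos (hκ : κ ≤ 0) :
    ∃ a b B : ℝ → ℝ, IsTrigTriple κ a b B ∧ ∀ t, 0 < t → a t * B t < b t ^ 2 := by
  rcases hκ.eq_or_lt with rfl | hlt
  · exact ⟨_, _, _, of_zero, fun t ht => of_zero.lt_sq_of_pos (fun s hs => hs) ht⟩
  · have hω : 0 < √(-κ) := Real.sqrt_pos.2 (by linarith)
    have h := of_neg hω
    rw [Real.sq_sqrt (by linarith), neg_neg] at h
    refine ⟨_, _, _, h, fun t ht => h.lt_sq_of_pos (fun s hs => ?_) ht⟩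
    exact div_pos (Real.sinh_pos_iff.2 (mul_pos hω hs)) hω

/-- Passing to the half angle `y = ωt/2` splits `aB - b²` into the two factors responsible for the
two interlaced families of conjugate times. -/
theorem discriminant_of_pos {ω : ℝ} (hω : 0 < ω) (t : ℝ) :
    Real.sin (ω * t) / ω * ((ω * t - Real.sin (ω * t)) / ω ^ 3) -
        ((1 - Real.cos (ω * t)) / ω ^ 2) ^ 2 =
      -(4 / ω ^ 4) * (Real.sin (ω * t / 2) *
        (Real.sin (ω * t / 2) - ω * t / 2 * Real.cos (ω * t / 2))) := by
  obtain ⟨y, hy⟩ : ∃ y, y = ω * t / 2 := ⟨_, rfl⟩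
  have h2 : ω * t = 2 * y := by rw [hy]; ring
  rw [← hy, h2, Real.sin_two_mul, Real.cos_two_mul]
  field_simp
  linear_combination (-4 * Real.cos y ^ 2 + 4) * Real.sin_sq_add_cos_sq y
end IsTrigTriple
end SubRiem

/-! ### The differential of `Expᵢ` and the criterion for conjugate times. -/

namespace SubRiem
open Matrix Topology
section
attribute [local instance] Matrix.linftyOpNormedRing Matrix.linftyOpNormedAlgebra

theorem exp_neg_mul (A : Mat4) (t : ℝ) :
    NormedSpace.exp (t • (-A)) * NormedSpace.exp (t • A) = 1 := by
  simpa using exp_mul_neg (-A) t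

theorem eq_exp_smul_of_hasDerivAt {A : Mat4} {M : ℝ → Mat4} (h0 : M 0 = 1)
    (hM : ∀ s, HasDerivAt M (A * M s) s) (t : ℝ) : NormedSpace.exp (t • A) = M t := by
  have key := const_of_deriv (f := fun s => NormedSpace.exp (s • (-A)) * M s) (fun s => by
    refine ((hasDerivAt_exp' (-A) s).mul (hM s)).congr_deriv ?_
    simp only [mul_neg, neg_mul, mul_assoc]
    abel) t
  simp only [zero_smul, NormedSpace.exp_zero, one_mul, h0] at key
  have := exp_mul_neg A t
  rw [neg_smul, ← smul_neg] at this
  calc NormedSpace.exp (t • A) = NormedSpace.exp (t • A) * (NormedSpace.exp (t • (-A)) * M t) := by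
        rw [key, mul_one]
    _ = M t := by rw [← mul_assoc, this, one_mul]

/-- Cayley–Hamilton for `ad x` on `𝔰𝔬(2,1)`, whose eigenvalues are `0` and `±√(-κ)`; the `ℝ` factor
is central. It makes the series of `exp(-s ad x)` collapse to three terms. -/
theorem brk_brk_brk (d : ℝ) (x h : Fin 4 → ℝ) : brk d x (brk d x (brk d x h)) =
    (-((d * x 1 + x 3) ^ 2 - x 0 ^ 2 - x 2 ^ 2)) • brk d x h := by
  ext k; fin_cases k <;> simp [brk] <;> ring

variable {κ : ℝ} {a b B : ℝ → ℝ} {x : Fin 4 → ℝ} {d : ℝ}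

/-- The coefficients solve the linear system expressing `exp(-s ad x)` in `1`, `ad x`, `(ad x)²`.
Conjugating the right-hand side back by `exp(sX)` gives a curve with zero derivative, hence
constantly equal to its value at `0`. -/
theorem conj_comb (hT : IsTrigTriple κ a b B) (hκ : κ = (d * x 1 + x 3) ^ 2 - x 0 ^ 2 - x 2 ^ 2)
    (h : Fin 4 → ℝ) (s : ℝ) :
    NormedSpace.exp (s • (-comb d x)) * comb d h * NormedSpace.exp (s • comb d x) =
      comb d h - a s • comb d (brk d x h) + b s • comb d (brk d x (brk d x h)) := by
  set X := comb d x with hX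
  set H0 := comb d h
  set H1 := comb d (brk d x h) with hH1
  set H2 := comb d (brk d x (brk d x h)) with hH2
  have e1 : X * H0 = H0 * X + H1 := by rw [hH1, ← comb_bracket]; abel
  have e2 : X * H1 = H1 * X + H2 := by rw [hH2, ← comb_bracket]; abel
  have e3 : X * H2 = H2 * X - κ • H1 := by
    have := comb_bracket d x (brk d x (brk d x h))
    rw [brk_brk_brk, comb_smul, ← hκ] at this
    rw [hH1, hX, hH2, sub_eq_add_neg, ← neg_smul, ← this]; abel
  have key := const_of_deriv (f := fun s => NormedSpace.exp (s • X) *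
    (H0 - a s • H1 + b s • H2) * NormedSpace.exp (s • (-X))) (fun s => by
      refine (((hasDerivAt_exp' X s).mul ((((hT.deriv_a s).smul_const H1).const_sub H0).add
        ((hT.deriv_b s).smul_const H2))).mul (hasDerivAt_exp' (-X) s)).congr_deriv ?_
      have hc : NormedSpace.exp (s • (-X)) * X = X * NormedSpace.exp (s • (-X)) :=
        (((Commute.refl X).neg_left.smul_left s).exp_left).eq
      have hE : X * (H0 - a s • H1 + b s • H2) + (-((1 - κ * b s) • H1) + a s • H2) =
          (H0 - a s • H1 + b s • H2) * X := by
        simp only [mul_add, mul_sub, add_mul, sub_mul, mul_smul_comm, smul_mul_assoc, e1, e2, e3]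
        module
      simp only [Pi.mul_apply, Pi.add_apply]
      rw [mul_neg, hc, mul_assoc (NormedSpace.exp (s • X)) X, ← mul_add, hE]
      simp only [mul_assoc, mul_neg]
      abel) s
  simp only [zero_smul, NormedSpace.exp_zero, one_mul, mul_one, hT.a_zero, hT.b_zero, sub_zero,
    add_zero] at key
  refine (congrArg (fun M => NormedSpace.exp (s • (-X)) * M * NormedSpace.exp (s • X))
    key.symm).trans ?_
  rw [← mul_assoc, ← mul_assoc, exp_neg_mul, one_mul, mul_assoc, exp_neg_mul, mul_one]

/-- The integral of `exp(-s ad x) h` over `0 ≤ s ≤ t`, in coordinates. -/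
def integratedAd (d : ℝ) (b B : ℝ → ℝ) (x h : Fin 4 → ℝ) (t : ℝ) : Fin 4 → ℝ :=
  t • h - b t • brk d x h + B t • brk d x (brk d x h)

theorem fderiv_exp_comb (hT : IsTrigTriple κ a b B)
    (hκ : κ = (d * x 1 + x 3) ^ 2 - x 0 ^ 2 - x 2 ^ 2) (h : Fin 4 → ℝ) (t : ℝ) :
    fderiv ℝ (NormedSpace.exp : Mat4 → Mat4) (t • comb d x) (t • comb d h) =
      NormedSpace.exp (t • comb d x) * comb d (integratedAd d b B x h t) := by
  have hcomb : ∀ s, comb d (integratedAd d b B x h s) = s • comb d h - b s • comb d (brk d x h) +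
      B s • comb d (brk d x (brk d x h)) := by
    intro s
    rw [integratedAd, comb_add, comb_smul, sub_eq_add_neg, ← neg_smul, comb_add, comb_smul,
      comb_smul, neg_smul, ← sub_eq_add_neg]
  rw [hcomb]
  refine fderiv_exp_apply (comb d x) (comb d h) (U := fun s => s • comb d h -
    b s • comb d (brk d x h) + B s • comb d (brk d x (brk d x h))) ?_ (fun s => ?_) t
  · simp [hT.b_zero, hT.B_zero]
  · rw [conj_comb hT hκ]
    refine ((((hasDerivAt_id s).smul_const (comb d h)).sub ((hT.deriv_b s).smul_const _)).add
      ((hT.deriv_B s).smul_const _)).congr_deriv ?_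
    rw [one_smul]

theorem expMap_apply {i : MetricIndex} (hd : ∀ v : Fin 4 → ℝ, ∑ k, v k • frame i k = comb d v)
    (p : (Fin 3 → ℝ) × ℝ × ℝ) :
    expMap i p = NormedSpace.exp (p.2.2 • comb d ![p.1 0, p.1 1, p.1 2, p.2.1]) *
      NormedSpace.exp ((-(p.2.2 * p.2.1)) • comb d (Pi.single 3 1)) := by
  rw [expMap, ← hd, ← frame_eq hd 3]
  simp [Fin.sum_univ_four]

theorem differentiable_expMap (i : MetricIndex) : Differentiable ℝ (expMap i) := by
  refine Differentiable.mul (differentiable_matrix_exp.comp ?_) (differentiable_matrix_exp.comp ?_)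
    <;> fun_prop

/-- A change `τ` of time is absorbed into the initial covector, since `(t + ετ)(x + εη) = t(x + ε(η
+ (τ/t)x))` to first order; hence the form of `h`. The exponent of the second factor is then `-tβ -
ε t h₄` to first order, which gives the subtracted `e₄` term. -/
theorem fderiv_expMap {i : MetricIndex} (hd : ∀ v : Fin 4 → ℝ, ∑ k, v k • frame i k = comb d v)
    {α : Fin 3 → ℝ} {β t : ℝ} (ht : t ≠ 0) (hT : IsTrigTriple κ a b B)
    (hκ : κ = (d * α 1 + β) ^ 2 - α 0 ^ 2 - α 2 ^ 2) (ξ : (Fin 3 → ℝ) × ℝ × ℝ) {h : Fin 4 → ℝ}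
    (hh : h = ![ξ.1 0, ξ.1 1, ξ.1 2, ξ.2.1] + (ξ.2.2 / t) • ![α 0, α 1, α 2, β]) :
    fderiv ℝ (expMap i) (α, β, t) ξ =
      NormedSpace.exp (t • comb d ![α 0, α 1, α 2, β]) *
        comb d (integratedAd d b B ![α 0, α 1, α 2, β] h t - (t * h 3) • Pi.single 3 1) *
          NormedSpace.exp ((-(t * β)) • comb d (Pi.single 3 1)) := by
  set x : Fin 4 → ℝ := ![α 0, α 1, α 2, β] with hx
  set η : Fin 4 → ℝ := ![ξ.1 0, ξ.1 1, ξ.1 2, ξ.2.1] with hη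
  set K := comb d (Pi.single 3 1) with hK
  set τ := ξ.2.2 with hτ
  have hline : HasDerivAt (fun ε : ℝ => ((α, β, t) : (Fin 3 → ℝ) × ℝ × ℝ) + ε • ξ) ξ 0 := by
    refine (((hasDerivAt_id (0 : ℝ)).smul_const ξ).const_add _).congr_deriv ?_
    rw [one_smul]
  have h1 := HasFDerivAt.comp_hasDerivAt_of_eq (0 : ℝ)
    (differentiable_expMap i (α, β, t)).hasFDerivAt hline (by simp)
  have hA : HasDerivAt (fun ε : ℝ => (t + ε * τ) • (comb d x + ε • comb d η)) (t • comb d h) 0 := by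
    have hs : HasDerivAt (fun ε : ℝ => t + ε * τ) τ 0 := by
      simpa using ((hasDerivAt_id (0 : ℝ)).mul_const τ).const_add t
    have hm : HasDerivAt (fun ε : ℝ => comb d x + ε • comb d η) (comb d η) 0 :=
      (((hasDerivAt_id (0 : ℝ)).smul_const (comb d η)).const_add _).congr_deriv (one_smul _ _)
    refine (hs.smul hm).congr_deriv ?_
    have e : t • (τ / t) • comb d x = τ • comb d x := by
      rw [smul_smul, mul_div_assoc', mul_div_cancel_left₀ _ ht]
    rw [hh, comb_add, comb_smul, smul_add t, e]
    simp
  have hE := HasFDerivAt.comp_hasDerivAt_of_eq (0 : ℝ)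
    (differentiable_matrix_exp (t • comb d x)).hasFDerivAt hA (by simp)
  replace hE := hE.congr_deriv (fderiv_exp_comb hT (by simpa [hx] using hκ) h t)
  have hθ : HasDerivAt (fun ε : ℝ => -((t + ε * τ) * (β + ε * ξ.2.1))) (-(t * h 3)) 0 := by
    have hs : HasDerivAt (fun ε : ℝ => t + ε * τ) τ 0 := by
      simpa using ((hasDerivAt_id (0 : ℝ)).mul_const τ).const_add t
    have hs' : HasDerivAt (fun ε : ℝ => β + ε * ξ.2.1) ξ.2.1 0 := by
      simpa using ((hasDerivAt_id (0 : ℝ)).mul_const ξ.2.1).const_add β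
    refine (hs.mul hs').neg.congr_deriv ?_
    rw [hh, hη, hx]
    simp
    field_simp
    ring
  have hR : HasDerivAt (fun ε : ℝ => NormedSpace.exp ((-((t + ε * τ) * (β + ε * ξ.2.1))) • K))
      ((-(t * h 3)) • (NormedSpace.exp ((-(t * β)) • K) * K)) 0 := by
    have := HasDerivAt.scomp_of_eq (0 : ℝ) (hasDerivAt_exp' K (-(t * β))) hθ (by simp)
    exact this
  have h2 := hE.mul hR
  have hfun : (expMap i ∘ fun ε : ℝ => ((α, β, t) : (Fin 3 → ℝ) × ℝ × ℝ) + ε • ξ) =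
      (NormedSpace.exp ∘ fun ε : ℝ => (t + ε * τ) • (comb d x + ε • comb d η)) *
        fun ε : ℝ => NormedSpace.exp ((-((t + ε * τ) * (β + ε * ξ.2.1))) • K) := by
    funext ε
    simp only [Function.comp_apply, Pi.mul_apply]
    rw [expMap_apply hd, ← comb_smul d ε η, ← comb_add]
    congr 4
    ext k; fin_cases k <;> simp [hx, hη]
  rw [hfun] at h1
  refine (h1.unique h2).trans ?_
  have hcomm : NormedSpace.exp ((-(t * β)) • K) * K = K * NormedSpace.exp ((-(t * β)) • K) :=
    (((Commute.refl K).smul_left _).exp_left).eq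
  rw [sub_eq_add_neg, ← neg_smul, comb_add, comb_smul, ← hK, hcomm]
  simp only [Function.comp_apply, zero_mul, add_zero, zero_smul, mul_add, add_mul, mul_assoc,
    mul_smul_comm, smul_mul_assoc]

/-- The outer exponential factors are invertible and drop out. Tangent vectors of `𝕊² × ℝ × ℝ₊`
correspond bijectively to vectors `h ∈ ℝ⁴`: the time direction supplies the radial component of `α`
that tangency to the sphere omits. -/
theorem isConjugateTime_iff_exists {i : MetricIndex}
    (hd : ∀ v : Fin 4 → ℝ, ∑ k, v k • frame i k = comb d v)
    {α : Fin 3 → ℝ} {β t : ℝ} (hα : α ∈ unitSphere) (ht : 0 < t) (hT : IsTrigTriple κ a b B)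
    (hκ : κ = (d * α 1 + β) ^ 2 - α 0 ^ 2 - α 2 ^ 2) :
    IsConjugateTime i α β t ↔ ∃ h : Fin 4 → ℝ, h ≠ 0 ∧
      integratedAd d b B ![α 0, α 1, α 2, β] h t = (t * h 3) • Pi.single 3 1 := by
  have hα' : α 0 ^ 2 + α 1 ^ 2 + α 2 ^ 2 = 1 := hα
  have hzero : ∀ (ξ : (Fin 3 → ℝ) × ℝ × ℝ) (h : Fin 4 → ℝ),
      h = ![ξ.1 0, ξ.1 1, ξ.1 2, ξ.2.1] + (ξ.2.2 / t) • ![α 0, α 1, α 2, β] →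
      (fderiv ℝ (expMap i) (α, β, t) ξ = 0 ↔
        integratedAd d b B ![α 0, α 1, α 2, β] h t = (t * h 3) • Pi.single 3 1) := by
    intro ξ h hh
    rw [fderiv_expMap hd ht.ne' hT hκ ξ hh]
    set Y := integratedAd d b B ![α 0, α 1, α 2, β] h t - (t * h 3) • Pi.single 3 1 with hY
    have hc0 : comb d 0 = 0 := by simpa using comb_smul d 0 0
    constructor
    · intro h0
      have hY0 : comb d Y = 0 := by
        have e1 := exp_neg_mul (comb d ![α 0, α 1, α 2, β]) t
        have e2 := exp_mul_neg (comb d (Pi.single 3 1)) (-(t * β))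
        have := congrArg (fun M => NormedSpace.exp (t • (-comb d ![α 0, α 1, α 2, β])) * M *
          NormedSpace.exp ((- -(t * β)) • comb d (Pi.single 3 1))) h0
        simp only [mul_zero, zero_mul] at this
        rw [← mul_assoc, ← mul_assoc, e1, one_mul, mul_assoc, e2, mul_one] at this
        exact this
      exact sub_eq_zero.1 (comb_inj (hY0.trans hc0.symm))
    · intro h0
      rw [hY, h0, sub_self, hc0, mul_zero, zero_mul]
  constructor
  · rintro ⟨_, ξ, hξ, hperp, h0⟩
    refine ⟨_, fun hh => hξ ?_, (hzero ξ _ rfl).1 h0⟩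
    have c0 := congrFun hh 0
    have c1 := congrFun hh 1
    have c2 := congrFun hh 2
    have c3 := congrFun hh 3
    simp at c0 c1 c2 c3
    -- Pair the first three coordinates of `h = 0` with `α`: tangency kills the sphere part and `|α|
    -- = 1` isolates `τ/t`.
    have hτ : ξ.2.2 / t = 0 := by
      linear_combination α 0 * c0 + α 1 * c1 + α 2 * c2 - hperp - ξ.2.2 / t * hα'
    rw [hτ] at c0 c1 c2 c3
    have hτ' : ξ.2.2 = 0 := by simpa [ht.ne'] using hτ
    refine Prod.ext ?_ (Prod.ext ?_ hτ')
    · ext k; fin_cases k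
      · simpa using c0
      · simpa using c1
      · simpa using c2
    · simpa using c3
  · rintro ⟨h, hh, h0⟩
    -- The radial component of `h` along `α`; removing it leaves a tangent vector, and the time
    -- variation `t r` restores it.
    obtain ⟨r, hr⟩ : ∃ r, r = h 0 * α 0 + h 1 * α 1 + h 2 * α 2 := ⟨_, rfl⟩
    have hξh : h = ![h 0 - r * α 0, h 1 - r * α 1, h 2 - r * α 2, h 3 - r * β] +
        (t * r / t) • ![α 0, α 1, α 2, β] := by
      rw [mul_div_cancel_left₀ _ ht.ne']
      ext k; fin_cases k <;> simp
    refine ⟨ht, (![h 0 - r * α 0, h 1 - r * α 1, h 2 - r * α 2], h 3 - r * β, t * r), ?_, ?_,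
      (hzero _ h (by simpa using hξh)).2 h0⟩
    · intro hξ
      rw [Prod.ext_iff, Prod.ext_iff] at hξ
      obtain ⟨g1, g2, g3⟩ := hξ
      have k0 := congrFun g1 0
      have k1 := congrFun g1 1
      have k2 := congrFun g1 2
      simp [ht.ne'] at k0 k1 k2 g2 g3
      rw [g3] at k0 k1 k2 g2
      refine hh ?_
      ext k; fin_cases k
      · simpa using k0
      · simpa using k1
      · simpa using k2
      · simpa using g2
    · simp
      linear_combination -hr - r * hα'

theorem exists_integratedAd_iff (d : ℝ) (b B : ℝ → ℝ) (x : Fin 4 → ℝ) {t : ℝ} (ht : 0 < t) :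
    (∃ h : Fin 4 → ℝ, h ≠ 0 ∧ integratedAd d b B x h t = (t * h 3) • Pi.single 3 1) ↔
      (x 0 ^ 2 + x 2 ^ 2) * ((t - ((d * x 1 + x 3) ^ 2 - x 0 ^ 2 - x 2 ^ 2) * B t) * B t -
        b t ^ 2) = 0 := by
  obtain ⟨σ, hσ⟩ : ∃ σ, σ = d * x 1 + x 3 := ⟨_, rfl⟩
  -- The system in the coordinates `h₁, h₃, h₄`. In the last row, the term `t h₄` of the integral
  -- has cancelled against the right-hand side.
  set M : Matrix (Fin 3) (Fin 3) ℝ :=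
    !![t + B t * (x 2 ^ 2 - σ ^ 2), -b t * σ - B t * x 0 * x 2, b t * x 2 + B t * σ * x 0;
      b t * σ - B t * x 0 * x 2, t + B t * (x 0 ^ 2 - σ ^ 2), -b t * x 0 + B t * σ * x 2;
      b t * x 2 - B t * σ * x 0, -b t * x 0 - B t * σ * x 2, B t * (x 0 ^ 2 + x 2 ^ 2)] with hM
  have hdet : M.det = t * ((x 0 ^ 2 + x 2 ^ 2) *
      ((t - (σ ^ 2 - x 0 ^ 2 - x 2 ^ 2) * B t) * B t - b t ^ 2)) := by
    rw [Matrix.det_fin_three]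
    simp [hM]
    ring
  have hiff : ∀ p q k : ℝ, integratedAd d b B x ![p, 0, q, k] t = (t * k) • Pi.single 3 1 ↔
      M *ᵥ ![p, q, k] = 0 := by
    intro p q k
    constructor
    · intro h
      have h0 := congrFun h 0
      have h2 := congrFun h 2
      have h3 := congrFun h 3
      simp [integratedAd, brk, ← hσ] at h0 h2 h3
      ext j; fin_cases j <;> simp [hM, Matrix.mulVec, dotProduct, Fin.sum_univ_three]
      · linear_combination h0
      · linear_combination h2
      · linear_combination h3
    · intro h
      have h0 := congrFun h 0
      have h1 := congrFun h 1
      have h2 := congrFun h 2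
      simp [hM, Matrix.mulVec, dotProduct, Fin.sum_univ_three] at h0 h1 h2
      ext j; fin_cases j <;> simp [integratedAd, brk, ← hσ]
      · linear_combination h0
      · linear_combination h1
      · linear_combination h2
  rw [← hσ]
  have hdet0 : M.det = 0 ↔ (x 0 ^ 2 + x 2 ^ 2) *
      ((t - (σ ^ 2 - x 0 ^ 2 - x 2 ^ 2) * B t) * B t - b t ^ 2) = 0 := by
    rw [hdet, mul_eq_zero, or_iff_right ht.ne']
  rw [← hdet0, ← Matrix.exists_mulVec_eq_zero_iff]
  constructor
  · rintro ⟨h, hh, h0⟩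
    -- Brackets have no component along the central direction, so this coordinate of the equation is
    -- just `t h₂ = 0`.
    have h1 : h 1 = 0 := by
      have h2 : t * h 1 - b t * 0 + B t * 0 = t * h 3 * (Pi.single 3 1 : Fin 4 → ℝ) 1 :=
        congrFun h0 1
      simpa [ht.ne'] using h2
    have hform : h = ![h 0, 0, h 2, h 3] := by
      ext k; fin_cases k <;> simp [h1]
    refine ⟨![h 0, h 2, h 3], fun hz => hh ?_, (hiff _ _ _).1 (hform ▸ h0)⟩
    have k0 := congrFun hz 0
    have k1 := congrFun hz 1
    have k2 := congrFun hz 2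
    simp at k0 k1 k2
    rw [hform, k0, k1, k2]
    ext k; fin_cases k <;> rfl
  · rintro ⟨v, hv, h0⟩
    have hform : v = ![v 0, v 1, v 2] := by
      ext k; fin_cases k <;> simp
    refine ⟨![v 0, 0, v 1, v 2], fun hz => hv ?_, (hiff _ _ _).2 (hform ▸ h0)⟩
    have k0 := congrFun hz 0
    have k1 := congrFun hz 2
    have k2 := congrFun hz 3
    simp at k0 k1 k2
    rw [hform, k0, k1, k2]
    ext k; fin_cases k <;> rfl

theorem isConjugateTime_iff {i : MetricIndex}
    (hd : ∀ v : Fin 4 → ℝ, ∑ k, v k • frame i k = comb d v)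
    {α : Fin 3 → ℝ} {β t : ℝ} (hα : α ∈ unitSphere) (ht : 0 < t) (hT : IsTrigTriple κ a b B)
    (hκ : κ = (d * α 1 + β) ^ 2 - α 0 ^ 2 - α 2 ^ 2) :
    IsConjugateTime i α β t ↔
      (α 0 ^ 2 + α 2 ^ 2) * (a t * B t - b t ^ 2) = 0 := by
  rw [isConjugateTime_iff_exists hd hα ht hT hκ, exists_integratedAd_iff d b B _ ht, hT.a_eq, hκ]
  simp

/-- The `𝔰𝔬(2,1)` part `N` satisfies `N³ = -κN` and annihilates `E₄` on both sides, so the same `a`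
and `b` that describe `exp(-s ad x)` give the exponential in closed form. -/
theorem exp_comb (hT : IsTrigTriple κ a b B)
    (hκ : κ = (d * x 1 + x 3) ^ 2 - x 0 ^ 2 - x 2 ^ 2) {N : Mat4}
    (hN : N = comb 0 ![x 0, 0, x 2, d * x 1 + x 3]) (t : ℝ) :
    NormedSpace.exp (t • comb d x) =
      1 + a t • N + b t • (N * N) + (Real.exp (t * x 1) - 1) • basisE4 := by
  have hE := basis_eq.2.2.2
  have hX : comb d x = N + x 1 • basisE4 := by
    rw [hE, hN]
    ext j k; fin_cases j <;> fin_cases k <;> simp [comb]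
  have hNE : N * basisE4 = 0 := by
    rw [hE, hN]
    ext j k; fin_cases j <;> fin_cases k <;> simp [comb]
  have hEN : basisE4 * N = 0 := by
    rw [hE, hN]
    ext j k; fin_cases j <;> fin_cases k <;> simp [comb]
  have hEE : basisE4 * basisE4 = basisE4 := by
    rw [hE]
    ext j k; fin_cases j <;> fin_cases k <;> simp
  have hN3 : N * (N * N) = (-κ) • N := by
    rw [hN, hκ]
    ext j k; fin_cases j <;> fin_cases k <;> simp [comb] <;> ring
  refine eq_exp_smul_of_hasDerivAt (A := comb d x) (M := fun t =>
    1 + a t • N + b t • (N * N) + (Real.exp (t * x 1) - 1) • basisE4) ?_ (fun s => ?_) t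
  · simp [hT.a_zero, hT.b_zero]
  · have hexp : HasDerivAt (fun s => Real.exp (s * x 1) - 1) (Real.exp (s * x 1) * x 1) s := by
      simpa using (((hasDerivAt_id s).mul_const (x 1)).exp).sub_const 1
    refine (((((hT.deriv_a s).smul_const N).const_add 1).add
      ((hT.deriv_b s).smul_const (N * N))).add (hexp.smul_const basisE4)).congr_deriv ?_
    rw [hX]
    have hENN : basisE4 * (N * N) = 0 := by rw [← mul_assoc, hEN, zero_mul]
    simp only [add_mul, mul_add, mul_one, mul_smul_comm, smul_mul_assoc, hNE, hEN, hEE, hN3, hENN,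
      smul_zero]
    module

end
end SubRiem

/-! ### The positive zeros of `sin y (sin y - y cos y)`. -/

namespace SubRiem

theorem hasDerivAt_sin_sub_mul_cos (y : ℝ) :
    HasDerivAt (fun y => Real.sin y - y * Real.cos y) (y * Real.sin y) y :=
  ((Real.hasDerivAt_sin y).sub ((hasDerivAt_id y).mul (Real.hasDerivAt_cos y))).congr_deriv
    (by simp)

theorem continuous_sin_sub_mul_cos : Continuous fun y => Real.sin y - y * Real.cos y := by
  fun_prop

theorem tan_eq_self_iff {y : ℝ} (hy : 0 < y) :
    Real.tan y = y ↔ Real.sin y - y * Real.cos y = 0 := by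
  rw [Real.tan_eq_sin_div_cos]
  by_cases hc : Real.cos y = 0
  · have hs : Real.sin y ≠ 0 := by
      intro h
      simpa [h, hc] using Real.sin_sq_add_cos_sq y
    simp [hc, hs, hy.ne]
  · rw [div_eq_iff hc, sub_eq_zero]

/-- `sin y - y cos y`, with the sign of `sin y` removed, in the `m`-th half-period. -/
theorem strictMonoOn_signed (m : ℕ) :
    StrictMonoOn (fun y => (-1 : ℝ) ^ m * (Real.sin y - y * Real.cos y))
      (Set.Icc (m * Real.pi) ((m + 1) * Real.pi)) := by
  refine strictMonoOn_of_deriv_pos (convex_Icc _ _)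
    (continuous_const.mul continuous_sin_sub_mul_cos).continuousOn fun y hy => ?_
  rw [interior_Icc] at hy
  rw [((hasDerivAt_sin_sub_mul_cos y).const_mul _).deriv]
  have hy0 : 0 < y := lt_of_le_of_lt (by positivity) hy.1
  have hs : 0 < Real.sin (y - m * Real.pi) :=
    Real.sin_pos_of_pos_of_lt_pi (by linarith [hy.1]) (by linarith [hy.2])
  rw [Real.sin_sub_nat_mul_pi] at hs
  have := mul_pos hy0 hs
  linarith

theorem signed_left (m : ℕ) : (-1 : ℝ) ^ m * (Real.sin (m * Real.pi) -
    m * Real.pi * Real.cos (m * Real.pi)) = -(m * Real.pi) := by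
  rw [Real.sin_nat_mul_pi, Real.cos_nat_mul_pi]
  have : (-1 : ℝ) ^ m * (-1) ^ m = 1 := by rw [← mul_pow]; simp
  linear_combination (-(m * Real.pi)) * this

theorem signed_right (m : ℕ) : (-1 : ℝ) ^ m * (Real.sin ((m + 1) * Real.pi) -
    (m + 1) * Real.pi * Real.cos ((m + 1) * Real.pi)) = (m + 1) * Real.pi := by
  have h := signed_left (m + 1)
  rw [pow_succ] at h
  push_cast at h
  linear_combination -h

/-- On the `m`-th half-period the signed function rises from `-mπ` to `(m + 1)π`. The implication
makes the choice total; the value at `m = 0` is arbitrary. -/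
theorem exists_root (m : ℕ) : ∃ y, 1 ≤ m → y ∈ Set.Ioo (m * Real.pi) ((m + 1) * Real.pi) ∧
    Real.sin y - y * Real.cos y = 0 := by
  by_cases hm : 1 ≤ m
  · have hm' : (0 : ℝ) < m * Real.pi := mul_pos (by exact_mod_cast hm) Real.pi_pos
    have := intermediate_value_Ioo (a := m * Real.pi) (b := (m + 1) * Real.pi)
      (by linarith [Real.pi_pos])
      (continuous_const.mul continuous_sin_sub_mul_cos).continuousOn
      (f := fun y => (-1 : ℝ) ^ m * (Real.sin y - y * Real.cos y))
    simp only [signed_left, signed_right] at this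
    obtain ⟨y, hy, h0⟩ := this ⟨neg_neg_of_pos hm', by linarith [Real.pi_pos]⟩
    exact ⟨y, fun _ => ⟨hy, by simpa using h0⟩⟩
  · exact ⟨0, fun h => absurd h hm⟩

/-- The `m`-th positive root of `tan y = y`, for `m ≥ 1`. -/
noncomputable def tanRoot (m : ℕ) : ℝ := (exists_root m).choose

theorem tanRoot_mem {m : ℕ} (hm : 1 ≤ m) :
    tanRoot m ∈ Set.Ioo (m * Real.pi) ((m + 1) * Real.pi) :=
  ((exists_root m).choose_spec hm).1

theorem tanRoot_eq_zero {m : ℕ} (hm : 1 ≤ m) :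
    Real.sin (tanRoot m) - tanRoot m * Real.cos (tanRoot m) = 0 :=
  ((exists_root m).choose_spec hm).2

theorem tanRoot_pos {m : ℕ} (hm : 1 ≤ m) : 0 < tanRoot m :=
  lt_of_le_of_lt (by positivity) (tanRoot_mem hm).1

theorem exists_eq_tanRoot {y : ℝ} (hy : 0 < y) (h : Real.sin y - y * Real.cos y = 0) :
    ∃ m : ℕ, 1 ≤ m ∧ tanRoot m = y := by
  obtain ⟨m, hm⟩ : ∃ m : ℕ, m = ⌊y / Real.pi⌋₊ := ⟨_, rfl⟩
  have hp := Real.pi_pos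
  have h1 : m * Real.pi ≤ y := by
    rw [← le_div_iff₀ hp, hm]
    exact Nat.floor_le (by positivity)
  have h2 : y < (m + 1) * Real.pi := by
    rw [← div_lt_iff₀ hp, hm]
    exact Nat.lt_floor_add_one _
  have hmono := strictMonoOn_signed m
  -- On the half-period `m = 0` the function starts at `0` and increases strictly, so it has no
  -- positive root there.
  rcases Nat.eq_zero_or_pos m with h0 | hpos
  · subst h0
    have := hmono ⟨by simp, by simpa using hp.le⟩ ⟨h1, h2.le⟩ hy
    simp [h] at this
  · refine ⟨m, hpos, ?_⟩
    have hmem := tanRoot_mem hpos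
    exact hmono.injOn (Set.Ioo_subset_Icc_self hmem) ⟨h1, h2.le⟩
      (by simp only [h, tanRoot_eq_zero hpos])

theorem isAscendingList_tanRoot :
    IsAscendingList tanRoot {r : ℝ | 0 < r ∧ Real.tan r = r} := by
  constructor
  · refine strictMonoOn_of_lt_succ Set.ordConnected_Ici fun m _ hm _ => ?_
    have h1 := (tanRoot_mem hm).2
    have h2 := (tanRoot_mem (m := m + 1) (by omega)).1
    push_cast at h2
    exact h1.trans h2
  · ext r
    constructor
    · rintro ⟨m, hm, rfl⟩
      exact ⟨tanRoot_pos hm, (tan_eq_self_iff (tanRoot_pos hm)).2 (tanRoot_eq_zero hm)⟩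
    · rintro ⟨hr, ht⟩
      obtain ⟨m, hm, rfl⟩ := exists_eq_tanRoot hr ((tan_eq_self_iff hr).1 ht)
      exact ⟨m, hm, rfl⟩

/-- The positive zeros of `sin y (sin y - y cos y)` in ascending order, starting from the index
`1`. -/
noncomputable def interlacedRoot (n : ℕ) : ℝ :=
  if Even n then tanRoot (n / 2) else ((n + 1) / 2 : ℕ) * Real.pi

theorem interlacedRoot_even (m : ℕ) : interlacedRoot (2 * m) = tanRoot m := by
  simp [interlacedRoot]

theorem interlacedRoot_odd {m : ℕ} (hm : 1 ≤ m) : interlacedRoot (2 * m - 1) = m * Real.pi := by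
  have h1 : ¬ Even (2 * m - 1) := by
    rw [Nat.not_even_iff_odd]; exact ⟨m - 1, by omega⟩
  have h2 : (2 * m - 1 + 1) / 2 = m := by omega
  rw [interlacedRoot, if_neg h1, h2]

theorem isAscendingList_interlacedRoot :
    IsAscendingList interlacedRoot
      {y : ℝ | 0 < y ∧ Real.sin y * (Real.sin y - y * Real.cos y) = 0} := by
  constructor
  · refine strictMonoOn_of_lt_succ Set.ordConnected_Ici fun n _ hn _ => ?_
    rw [Set.mem_Ici] at hn
    rw [Order.succ_eq_add_one]
    rcases Nat.even_or_odd' n with ⟨m, rfl | rfl⟩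
    · have h := interlacedRoot_odd (m := m + 1) (by omega)
      rw [show 2 * (m + 1) - 1 = 2 * m + 1 by omega] at h
      rw [interlacedRoot_even, h]
      push_cast
      exact (tanRoot_mem (by omega)).2
    · have h := interlacedRoot_odd (m := m + 1) (by omega)
      rw [show 2 * (m + 1) - 1 = 2 * m + 1 by omega] at h
      rw [show 2 * m + 1 + 1 = 2 * (m + 1) by omega, interlacedRoot_even, h]
      exact (tanRoot_mem (by omega)).1
  · ext y
    constructor
    · rintro ⟨n, hn, rfl⟩
      rw [Set.mem_Ici] at hn
      rcases Nat.even_or_odd' n with ⟨m, rfl | rfl⟩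
      · have hm : 1 ≤ m := by omega
        rw [interlacedRoot_even]
        exact ⟨tanRoot_pos hm, by rw [tanRoot_eq_zero hm, mul_zero]⟩
      · have h := interlacedRoot_odd (m := m + 1) (by omega)
        rw [show 2 * (m + 1) - 1 = 2 * m + 1 by omega] at h
        rw [h]
        exact ⟨by positivity, by rw [Real.sin_nat_mul_pi, zero_mul]⟩
    · rintro ⟨hy, h⟩
      rcases mul_eq_zero.1 h with h | h
      · obtain ⟨k, hk⟩ := Real.sin_eq_zero_iff.1 h
        have hk0 : 0 < k := by
          by_contra hk'
          have : (k : ℝ) ≤ 0 := by exact_mod_cast not_lt.1 hk'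
          nlinarith [Real.pi_pos]
        lift k to ℕ using hk0.le
        have hk1 : 1 ≤ k := by omega
        exact ⟨2 * k - 1, Set.mem_Ici.2 (by omega), by
          rw [interlacedRoot_odd hk1, ← hk]; simp⟩
      · obtain ⟨m, hm, rfl⟩ := exists_eq_tanRoot hy h
        exact ⟨2 * m, Set.mem_Ici.2 (by omega), interlacedRoot_even m⟩

end SubRiem

/-! ### Conjugate times and the first conjugate locus. -/

namespace SubRiem
open Matrix

theorem exp_smul_frame_three (d θ : ℝ) :
    NormedSpace.exp (θ • comb d (Pi.single 3 1)) = blockElt (rotationFirstAxis θ) 0 := by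
  have hT := IsTrigTriple.of_pos one_pos
  rw [exp_comb (d := d) (x := Pi.single 3 1) hT (by simp) rfl θ, basis_eq.2.2.2]
  ext j k; fin_cases j <;> fin_cases k <;> simp [comb, blockElt, rotationFirstAxis]

theorem exp_comb_of_period {x : Fin 4 → ℝ} {d ω : ℝ} (hω : 0 < ω)
    (hκ : ω ^ 2 = (d * x 1 + x 3) ^ 2 - x 0 ^ 2 - x 2 ^ 2) :
    NormedSpace.exp ((2 * Real.pi / ω) • comb d x) = blockElt 1 (2 * Real.pi / ω * x 1) := by
  rw [exp_comb (IsTrigTriple.of_pos hω) hκ rfl, basis_eq.2.2.2]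
  have h : ω * (2 * Real.pi / ω) = 2 * Real.pi := by field_simp
  rw [h, Real.sin_two_pi, Real.cos_two_pi]
  ext j k; fin_cases j <;> fin_cases k <;> simp [blockElt]

theorem geodesic_of_period {i : MetricIndex} {d : ℝ}
    (hd : ∀ v : Fin 4 → ℝ, ∑ k, v k • frame i k = comb d v) {α : Fin 3 → ℝ} {β ω : ℝ} (hω : 0 < ω)
    (hκ : ω ^ 2 = (d * α 1 + β) ^ 2 - α 0 ^ 2 - α 2 ^ 2) :
    geodesic i α β (2 * Real.pi / ω) =
      blockElt (rotationFirstAxis (-(2 * Real.pi / ω * β))) (2 * Real.pi / ω * α 1) := by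
  rw [geodesic, expMap_apply hd, exp_smul_frame_three]
  rw [exp_comb_of_period hω (by simpa using hκ)]
  ext j k; fin_cases j <;> fin_cases k <;>
    simp [blockElt, rotationFirstAxis, Matrix.mul_apply, Fin.sum_univ_four]

theorem rotationFirstAxis_mem_SO21 (ψ : ℝ) : rotationFirstAxis ψ ∈ SO21 := by
  have h := Real.sin_sq_add_cos_sq ψ
  refine ⟨?_, ?_, ?_⟩
  · ext j k; fin_cases j <;> fin_cases k <;>
      simp [rotationFirstAxis, lorentzJ, Matrix.mul_apply, Fin.sum_univ_three] <;>
      first | ring1 | linear_combination h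
  · simp [Matrix.det_fin_three, rotationFirstAxis]
    linear_combination h
  · simp [rotationFirstAxis]

theorem rotationFirstAxis_add_int_mul_two_pi (ψ : ℝ) (n : ℤ) :
    rotationFirstAxis (ψ + n * (2 * Real.pi)) = rotationFirstAxis ψ := by
  simp [rotationFirstAxis]

theorem frame_comb_and_w (i : MetricIndex) : ∃ d : ℝ,
    (∀ v : Fin 4 → ℝ, ∑ k, v k • frame i k = comb d v) ∧
    ∀ {α : Fin 3 → ℝ}, α ∈ unitSphere → ∀ β,
      w i (α 1) β = Real.sqrt ((d * α 1 + β) ^ 2 - α 0 ^ 2 - α 2 ^ 2) := by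
  obtain ⟨d, hd⟩ := frame_comb i
  -- This entry of `e₂` equals `d`, which recovers the value hidden by the existential in
  -- `frame_comb`.
  have h12 := congrFun (congrFun (hd (Pi.single 1 1)) 2) 1
  obtain ⟨h1, h2, h3, h4⟩ := basis_eq
  refine ⟨d, hd, fun {α} hα β => ?_⟩
  have hα' : α 0 ^ 2 + α 1 ^ 2 + α 2 ^ 2 = 1 := hα
  cases i
  · have hd1 : d = 1 := by
      simpa [Fin.sum_univ_four, frame, h1, h2, h3, h4, comb] using h12.symm
    subst hd1
    rw [w]
    congr 1
    linear_combination hα'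
  · have hd0 : d = 0 := by
      simpa [Fin.sum_univ_four, frame, h1, h2, h3, h4, comb] using h12.symm
    subst hd0
    rw [w]
    congr 1
    linear_combination hα'

theorem sq_add_sq_eq_zero_iff {α : Fin 3 → ℝ} (hα : α ∈ unitSphere) :
    α 0 ^ 2 + α 2 ^ 2 = 0 ↔ α 1 = 1 ∨ α 1 = -1 := by
  have hα' : α 0 ^ 2 + α 1 ^ 2 + α 2 ^ 2 = 1 := hα
  rw [← sq_eq_one_iff]
  constructor <;> intro h <;> linarith

theorem conjugateTimes_of_degenerate {i : MetricIndex} {α : Fin 3 → ℝ} (hα : α ∈ unitSphere)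
    (h : α 0 ^ 2 + α 2 ^ 2 = 0) (β : ℝ) : conjugateTimes i α β = Set.Ioi 0 := by
  obtain ⟨d, hd⟩ := frame_comb i
  ext t
  refine ⟨fun ht => ht.1, fun ht => ?_⟩
  rcases le_or_gt ((d * α 1 + β) ^ 2 - α 0 ^ 2 - α 2 ^ 2) 0 with hκ | hκ
  · obtain ⟨a, b, B, hT, -⟩ := IsTrigTriple.exists_of_nonpos hκ
    exact (isConjugateTime_iff hd hα ht hT rfl).2 (by rw [h, zero_mul])
  · have hT := IsTrigTriple.of_pos (Real.sqrt_pos.2 hκ)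
    rw [Real.sq_sqrt hκ.le] at hT
    exact (isConjugateTime_iff hd hα ht hT rfl).2 (by rw [h, zero_mul])

theorem conjugateTimes_of_w_eq_zero {i : MetricIndex} {α : Fin 3 → ℝ} (hα : α ∈ unitSphere)
    (h : α 0 ^ 2 + α 2 ^ 2 ≠ 0) {β : ℝ} (hw : ¬ 0 < w i (α 1) β) :
    conjugateTimes i α β = ∅ := by
  obtain ⟨d, hd, hwd⟩ := frame_comb_and_w i
  rw [hwd hα, Real.sqrt_pos, not_lt] at hw
  obtain ⟨a, b, B, hT, hneg⟩ := IsTrigTriple.exists_of_nonpos hw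
  refine Set.eq_empty_of_forall_notMem fun t ht => ?_
  have := (isConjugateTime_iff hd hα ht.1 hT rfl).1 ht
  rcases mul_eq_zero.1 this with h0 | h0
  · exact h h0
  · linarith [hneg t ht.1]

theorem mem_conjugateTimes_iff {i : MetricIndex} {α : Fin 3 → ℝ} (hα : α ∈ unitSphere)
    (h : α 0 ^ 2 + α 2 ^ 2 ≠ 0) {β : ℝ} (hw : 0 < w i (α 1) β) (t : ℝ) :
    t ∈ conjugateTimes i α β ↔ 0 < w i (α 1) β * t / 2 ∧
      Real.sin (w i (α 1) β * t / 2) * (Real.sin (w i (α 1) β * t / 2) -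
        w i (α 1) β * t / 2 * Real.cos (w i (α 1) β * t / 2)) = 0 := by
  obtain ⟨d, hd, hwd⟩ := frame_comb_and_w i
  have hsq : w i (α 1) β ^ 2 = (d * α 1 + β) ^ 2 - α 0 ^ 2 - α 2 ^ 2 := by
    have hw' := hw
    rw [hwd hα, Real.sqrt_pos] at hw'
    rw [hwd hα, Real.sq_sqrt hw'.le]
  have ht : 0 < t ↔ 0 < w i (α 1) β * t / 2 := by
    rw [div_pos_iff_of_pos_right two_pos, mul_pos_iff_of_pos_left hw]
  rw [← ht]
  have hiff := fun ht : 0 < t =>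
    isConjugateTime_iff hd hα ht (IsTrigTriple.of_pos hw) hsq
  simp only [IsTrigTriple.discriminant_of_pos hw, mul_eq_zero (a := α 0 ^ 2 + α 2 ^ 2),
    mul_eq_zero (a := -(4 / w i (α 1) β ^ 4)), h, false_or,
    neg_ne_zero.2 (div_ne_zero four_ne_zero (pow_ne_zero 4 hw.ne'))] at hiff
  exact ⟨fun hc => ⟨hc.1, (hiff hc.1).1 hc⟩, fun hc => (hiff hc.1).2 hc.2⟩

theorem isAscendingList_conjugateTimes {i : MetricIndex} {α : Fin 3 → ℝ} (hα : α ∈ unitSphere)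
    (h : α 0 ^ 2 + α 2 ^ 2 ≠ 0) {β : ℝ} (hw : 0 < w i (α 1) β) :
    IsAscendingList (fun n => 2 * interlacedRoot n / w i (α 1) β) (conjugateTimes i α β) := by
  obtain ⟨hmono, himage⟩ := isAscendingList_interlacedRoot
  constructor
  · intro m hm n hn hmn
    have := hmono hm hn hmn
    simp only
    gcongr
  · ext t
    rw [mem_conjugateTimes_iff hα h hw]
    refine Iff.trans ?_ (Set.ext_iff.1 himage (w i (α 1) β * t / 2))
    simp only [Set.mem_image]
    refine exists_congr fun n => and_congr_right fun _ => ?_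
    rw [div_eq_iff hw.ne', eq_div_iff two_ne_zero, mul_comm _ (2 : ℝ), mul_comm t]

theorem isLeast_conjugateTimes {i : MetricIndex} {α : Fin 3 → ℝ} (hα : α ∈ unitSphere)
    (h : α 0 ^ 2 + α 2 ^ 2 ≠ 0) {β : ℝ} (hw : 0 < w i (α 1) β) :
    IsLeast (conjugateTimes i α β) (2 * Real.pi / w i (α 1) β) := by
  obtain ⟨hmono, himage⟩ := isAscendingList_conjugateTimes hα h hw
  have h1 : interlacedRoot 1 = Real.pi := by simpa using interlacedRoot_odd (m := 1) le_rfl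
  have h1' : (fun n => 2 * interlacedRoot n / w i (α 1) β) 1 = 2 * Real.pi / w i (α 1) β := by
    simp only [h1]
  rw [← himage, ← h1']
  refine ⟨⟨1, Set.mem_Ici.2 le_rfl, rfl⟩, ?_⟩
  rintro _ ⟨n, hn, rfl⟩
  exact hmono.monotoneOn (Set.mem_Ici.2 le_rfl) hn hn

theorem mem_firstConjugateLocus_iff {i : MetricIndex} {g : Mat4} :
    g ∈ firstConjugateLocus i ↔ ∃ α ∈ unitSphere, ∃ β, α 0 ^ 2 + α 2 ^ 2 ≠ 0 ∧
      0 < w i (α 1) β ∧ g = geodesic i α β (2 * Real.pi / w i (α 1) β) := by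
  constructor
  · rintro ⟨α, hα, β, t, hglb, ht, rfl⟩
    have h : α 0 ^ 2 + α 2 ^ 2 ≠ 0 := by
      intro h
      rw [conjugateTimes_of_degenerate hα h] at hglb
      exact ht.ne' (hglb.unique isGLB_Ioi)
    have hw : 0 < w i (α 1) β := by
      by_contra hw
      rw [conjugateTimes_of_w_eq_zero hα h hw] at hglb
      exact not_isTop t (isGLB_empty_iff.1 hglb)
    refine ⟨α, hα, β, h, hw, ?_⟩
    rw [hglb.unique (isLeast_conjugateTimes hα h hw).isGLB]
  · rintro ⟨α, hα, β, h, hw, rfl⟩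
    exact ⟨α, hα, β, _, (isLeast_conjugateTimes hα h hw).isGLB, by positivity, rfl⟩

/-- Used to replace `ψ` by an angle of the same rotation so large that the geodesic built in
`firstConjugateLocus_eq` has `|α₂| < 1`. -/
theorem exists_int_sq_gt (c ψ : ℝ) :
    ∃ n : ℤ, 4 * Real.pi ^ 2 < (c - (ψ + n * (2 * Real.pi))) ^ 2 := by
  obtain ⟨n, hn⟩ := exists_int_gt ((c - ψ) / (2 * Real.pi) + 1)
  have hp : 0 < 2 * Real.pi := by positivity
  refine ⟨n, ?_⟩
  have h1 : c - ψ + 2 * Real.pi < n * (2 * Real.pi) := by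
    have := mul_lt_mul_of_pos_right hn hp
    rwa [add_mul, one_mul, div_mul_cancel₀ _ hp.ne'] at this
  nlinarith

theorem firstConjugateLocus_eq (i : MetricIndex) : firstConjugateLocus i =
    {g | ∃ C ∈ SO21, ∃ ψ v : ℝ, C = rotationFirstAxis ψ ∧ g = blockElt C v} := by
  obtain ⟨d, hd, hwd⟩ := frame_comb_and_w i
  have hsq : ∀ {α : Fin 3 → ℝ}, α ∈ unitSphere → ∀ β, 0 < w i (α 1) β →
      w i (α 1) β ^ 2 = (d * α 1 + β) ^ 2 - α 0 ^ 2 - α 2 ^ 2 := by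
    intro α hα β hw
    rw [hwd hα, Real.sqrt_pos] at hw
    rw [hwd hα, Real.sq_sqrt hw.le]
  ext g
  rw [mem_firstConjugateLocus_iff]
  constructor
  · rintro ⟨α, hα, β, h, hw, rfl⟩
    exact ⟨_, rotationFirstAxis_mem_SO21 _, _, _, rfl, geodesic_of_period hd hw (hsq hα β hw)⟩
  · rintro ⟨_, -, ψ, v, rfl, rfl⟩
    obtain ⟨n, hn⟩ := exists_int_sq_gt (d * v) ψ
    obtain ⟨φ, hφ⟩ : ∃ φ, φ = ψ + n * (2 * Real.pi) := ⟨_, rfl⟩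
    rw [← hφ] at hn
    have hp := Real.pi_pos
    have hq : 0 < v ^ 2 + (d * v - φ) ^ 2 - 4 * Real.pi ^ 2 := by nlinarith [sq_nonneg v]
    -- Here `c` is the reciprocal of the desired time `2π/w`. The endpoint forces `α₂ = cv` and `β =
    -- -cφ`, and the condition `w = 2πc` becomes `c²(v² + (dv - φ)² - 4π²) = 1`.
    obtain ⟨c, hc⟩ : ∃ c, c = (Real.sqrt (v ^ 2 + (d * v - φ) ^ 2 - 4 * Real.pi ^ 2))⁻¹ := ⟨_, rfl⟩
    have hc0 : 0 < c := by rw [hc]; exact inv_pos.2 (Real.sqrt_pos.2 hq)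
    have hc2 : c ^ 2 * (v ^ 2 + (d * v - φ) ^ 2 - 4 * Real.pi ^ 2) = 1 := by
      rw [hc, inv_pow, Real.sq_sqrt hq.le, inv_mul_cancel₀ hq.ne']
    have hv : 0 < 1 - (c * v) ^ 2 := by
      have : 0 < c ^ 2 * ((d * v - φ) ^ 2 - 4 * Real.pi ^ 2) := by
        exact mul_pos (by positivity) (by linarith)
      linarith
    set α : Fin 3 → ℝ := ![Real.sqrt (1 - (c * v) ^ 2), c * v, 0] with hα_def
    have h1 : α 1 = c * v := by simp [hα_def]
    have h02 : α 0 ^ 2 + α 2 ^ 2 = 1 - (c * v) ^ 2 := by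
      simp [hα_def, Real.sq_sqrt hv.le]
    have hα : α ∈ unitSphere := by
      change α 0 ^ 2 + α 1 ^ 2 + α 2 ^ 2 = 1
      rw [h1]; linarith
    have hω : w i (α 1) (-(c * φ)) = 2 * Real.pi * c := by
      rw [hwd hα, ← Real.sqrt_sq (by positivity : 0 ≤ 2 * Real.pi * c)]
      congr 1
      rw [h1]
      linear_combination -h02 + hc2
    have hω0 : 0 < w i (α 1) (-(c * φ)) := by rw [hω]; positivity
    refine ⟨α, hα, -(c * φ), by rw [h02]; exact hv.ne', hω0, ?_⟩
    rw [geodesic_of_period hd hω0 (hsq hα _ hω0), hω, h1]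
    have e1 : -(2 * Real.pi / (2 * Real.pi * c) * -(c * φ)) = φ := by field_simp
    have e2 : 2 * Real.pi / (2 * Real.pi * c) * (c * v) = v := by field_simp
    rw [e1, e2, hφ, rotationFirstAxis_add_int_mul_two_pi]

end SubRiem

theorem corollary2 :
    (∃ x : ℕ → ℝ, SubRiem.IsAscendingList x {r : ℝ | 0 < r ∧ Real.tan r = r} ∧
      ∀ (i : SubRiem.MetricIndex) (α : Fin 3 → ℝ) (β : ℝ), α ∈ SubRiem.unitSphere →
        α 1 ≠ 1 → α 1 ≠ -1 → 0 < SubRiem.w i (α 1) β →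
        ∃ t : ℕ → ℝ, SubRiem.IsAscendingList t (SubRiem.conjugateTimes i α β) ∧
          ∀ m : ℕ, 1 ≤ m →
            t (2 * m - 1) = 2 * Real.pi * m / SubRiem.w i (α 1) β ∧
            t (2 * m) = 2 * x m / SubRiem.w i (α 1) β) ∧
    ∀ i : SubRiem.MetricIndex, SubRiem.firstConjugateLocus i =
      {g | ∃ C ∈ SubRiem.SO21, ∃ ψ v : ℝ,
        C = SubRiem.rotationFirstAxis ψ ∧ g = SubRiem.blockElt C v} := by
  refine ⟨⟨SubRiem.tanRoot, SubRiem.isAscendingList_tanRoot, ?_⟩, SubRiem.firstConjugateLocus_eq⟩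
  intro i α β hα h1 h2 hw
  have h : α 0 ^ 2 + α 2 ^ 2 ≠ 0 := fun h => by
    rcases (SubRiem.sq_add_sq_eq_zero_iff hα).1 h with h | h
    · exact h1 h
    · exact h2 h
  refine ⟨_, SubRiem.isAscendingList_conjugateTimes hα h hw, fun m hm => ⟨?_, ?_⟩⟩
  · rw [SubRiem.interlacedRoot_odd hm]
    ring
  · rw [SubRiem.interlacedRoot_even]
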